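/- **Theorem 6 (Rate of CD-BAC$_q$).** Let $A,\beta,\gamma>0$, $0<E\le A$, $Q(x)=\frac1{\sqrt{2\pi}}\int_x^\infty e^{-u^2/2}\,du$, $\bar\epsilon=2Q(\beta)$, $N=\lceil\log_2(\gamma(A+2\beta))\rceil$, $q\in\{1,\dots,N-1\}$, and let $\mathcal T_0,\dots,\mathcal T_{N-1}\subseteq\{0,1\}^q$. *Channel.* Let $K$ be an integer noise, independent of the input, with $$\mathcal P\{K=k\}=\frac{Q\big(\frac{k-\gamma\beta}{\gamma}\big)-Q\big(\frac{k+1-\gamma\beta}{\gamma}\big)}{Q\big(\frac{-\lceil\gamma A\rceil-\gamma\beta}{\gamma}\big)-Q\big(\frac{\lceil\gamma(A+2\beta)\rceil-\gamma\beta}{\gamma}\big)},\qquad -\lceil\gamma A\rceil\le k<\lceil\gamma(A+2\beta)\rceil$$ (the law of $\lfloor\gamma(Z+\beta)\rfloor$ for a standard Gaussian $Z$, conditioned on this range). Let $Z_i^b$, $0\le i<N$, be the bits of the $N$-bit two's complement representation of $K$ ($i=0$ is the least significant bit) and $\alpha_i=\mathcal P\{Z_i^b=1\}$. In one use, an input $(X_0^b,\dots,X_{N-1}^b)\in\{0,1\}^N$,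 sent as the intensity $X=\frac1\gamma\sum_i 2^iX_i^b$, yields $Y_i^b=(X_i^b+Z_i^b+W_i^b)\bmod 2$, where $W_0^b=0$ and $W_{i+1}^b=(X_i^bZ_i^b+X_i^bW_i^b+Z_i^bW_i^b)\bmod 2$. Put $Y_i^b=0$ for $i\ge N$. The whole output vector is erased with a probability $\epsilon\in[0,\bar\epsilon]$, independently of the input and the noise. Uses are independent. *Scheme.* Each bit-pipe $i$ has its own message, encoded by its own binary block code; bit-pipes with $p_i=0$ carry no message and always send $0$. Every transmitted block must satisfy $X\le A$ at each time and have time average of $X$ at most $E$. The receiver proceeds through $i=0,1,\dots,N-1$: at unerased times it adds its reconstruction of $W_i^b$ to $Y_i^b$ modulo $2$, changes the result from $0$ to $1$ whenever $\boldsymbol T_i^b=(Y_{i+1}^b,\dots,Y_{i+q}^b)\in\mathcal T_i$, decodes message $i$ from the resulting bits $\check Y_i^b$ and the erasures alone, and from the re-encoded decision reconstructs $Z_i^b$ and $W_{i+1}^b$. For $p\in[0,1]^N$ let $X_i^b\sim\mathrm{Bern}(p_i)$ be independent, and put $$\theta_i=\mathcal P\{\boldsymbol T_i^b\in\mathcal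 T_i\mid (X_i^b,Z_i^b)=(0,0)\},\qquad \bar\theta_i=\mathcal P\{\boldsymbol T_i^b\in\mathcal T_i\mid (X_i^b,Z_i^b)=(1,1)\},$$ $$\tilde\alpha_{i0}=\alpha_i+(1-\alpha_i)\theta_i,\qquad \tilde\alpha_{i1}=\alpha_i-\alpha_i\bar\theta_i,$$ $$\Phi_i(p)=\mathsf h\big((1-p_i)\tilde\alpha_{i0}+p_i(1-\tilde\alpha_{i1})\big)-(1-p_i)\,\mathsf h(\tilde\alpha_{i0})-p_i\,\mathsf h(\tilde\alpha_{i1}),$$ where $\mathsf h$ is the binary entropy function in bits (a conditional probability given a null event is taken to be $0$; this does not affect $\Phi_i$). Then: 1. For every $p\in[0,1]^N$ and every $i$, with exactly reconstructed carry bits and no erasure, the flipped output satisfies $\mathcal P\{\check Y_i^b=1\mid X_i^b=0\}=\tilde\alpha_{i0}$ if $p_i\ne1$, $\mathcal P\{\check Y_i^b=0\mid X_i^b=1\}=\tilde\alpha_{i1}$ if $p_i\neq0$, and $\Phi_i(p)=I(X_i^b;\check Y_i^b)$. 2. Over all $p\in[0,1]^N$ with $\sum_{i:\,p_i>0}2^i\le\gamma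 A$ and $\sum_{i:\,p_i>0}p_i2^i\le\gamma E$, the sum $\sum_{i=0}^{N-1}\Phi_i(p)$ has a maximum, and for a maximizer $p$ and every $\epsilon\in[0,\bar\epsilon]$ the scheme achieves the rate $$R_{\mathrm{CD\text{-}BAC}_q}=(1-\bar\epsilon)\max_p\sum_{i=0}^{N-1}\Phi_i(p)$$ bits per channel use. That is, for every $R'<R_{\mathrm{CD\text{-}BAC}_q}$ and $\delta>0$ and all sufficiently large block lengths, there are codes as above of total rate at least $R'$ whose probability that some message is decoded wrongly, averaged over independent uniform messages, is at most $\delta$. -/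

import Mathlib

open scoped BigOperators

noncomputable section

namespace CDBAC

/-! ### Noise, bit-pipes and carry bits -/

/-- Tail function of the standard Gaussian distribution. -/
def gaussQ (x : ℝ) : ℝ :=
  (1 / Real.sqrt (2 * Real.pi)) * ∫ u in Set.Ioi x, Real.exp (-u ^ 2 / 2)

/-- Upper bound `2 Q(β)` on the erasure probability. -/
def epsBar (β : ℝ) : ℝ := 2 * gaussQ β

/-- The values `k` that the quantized noise `⌊γ (Z + β)⌋` takes in the model. -/
def noiseRange (A β γ : ℝ) : Finset ℤ := Finset.Ico (-⌈γ * A⌉) ⌈γ * (A + 2 * β)⌉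

/-- Probability that `⌊γ (Z + β)⌋ = k`, for `Z` standard Gaussian conditioned on
`-⌈γ A⌉ ≤ γ (Z + β) < ⌈γ (A + 2 β)⌉` (used for `k ∈ noiseRange A β γ`). -/
def noiseProb (A β γ : ℝ) (k : ℤ) : ℝ :=
  (gaussQ (((k : ℝ) - γ * β) / γ) - gaussQ (((k : ℝ) + 1 - γ * β) / γ)) /
    (gaussQ ((-(⌈γ * A⌉ : ℝ) - γ * β) / γ) -
      gaussQ (((⌈γ * (A + 2 * β)⌉ : ℝ) - γ * β) / γ))

/-- Bit `i` of the `N`-bit two's complement representation of the integer noise `k`. -/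
def noiseBit (N : ℕ) (k : ℤ) (i : ℕ) : Bool :=
  decide ((((if k < 0 then 2 ^ N else 0) + k) / 2 ^ i) % 2 = 1)

/-- A vector of `N` bits, continued by zeros. -/
def bitAt {N : ℕ} (x : Fin N → Bool) (i : ℕ) : Bool :=
  if h : i < N then x ⟨i, h⟩ else false

/-- The carry-over bit produced by three bits: `ab + ac + bc` modulo 2. -/
def carryOut (a b c : Bool) : Bool := xor (xor (a && b) (a && c)) (b && c)

/-- The carry-over bit `W_i` entering bit-pipe `i`. -/
def carry {N : ℕ} (x : Fin N → Bool) (k : ℤ) : ℕ → Bool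
  | 0 => false
  | i + 1 => carryOut (bitAt x i) (noiseBit N k i) (carry x k i)

/-- Outputs of the vector binary channel: `Y_i = X_i + Z_i + W_i` modulo 2. -/
def output {N : ℕ} (x : Fin N → Bool) (k : ℤ) : Fin N → Bool :=
  fun i => xor (xor (x i) (noiseBit N k i)) (carry x k i)

/-- Transition probability of one use of the vector binary channel in which, independently of
everything else, the whole output vector is erased (`none`) with probability `ε`. -/
def transProb (A β γ ε : ℝ) {N : ℕ} (x : Fin N → Bool) : Option (Fin N → Bool) → ℝ
  | none => ε
  | some y => (1 - ε) * ∑ k ∈ noiseRange A β γ, if output x k = y then noiseProb A β γ k else 0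

/-! ### The flipping rule -/

/-- The outputs of the `q` bit-pipes above bit-pipe `i` (zero beyond the last bit-pipe). -/
def upper {N : ℕ} (q : ℕ) (y : Fin N → Bool) (i : Fin N) : Fin q → Bool :=
  fun j => bitAt y (i + 1 + j)

/-- Output of bit-pipe `i` after removal of the carry bit `w`, with `0` flipped to `1` when the
higher outputs lie in the set `S`. -/
def flipped {N q : ℕ} (S : Finset (Fin q → Bool)) (y : Fin N → Bool) (w : Bool) (i : Fin N) :
    Bool :=
  if xor (y i) w = false ∧ upper q y i ∈ S then true else xor (y i) w

/-! ### Law of one unerased channel use with independent Bernoulli inputs -/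

/-- Probability of the input vector `x` when the bits are independent, bit `i` being
Bernoulli with parameter `p i`. -/
def inputProb {N : ℕ} (p : Fin N → ℝ) (x : Fin N → Bool) : ℝ :=
  ∏ i, if x i then p i else 1 - p i

open Classical in
/-- Probability of an event on the input vector and the (independent) integer noise. -/
def prob (A β γ : ℝ) {N : ℕ} (p : Fin N → ℝ) (F : (Fin N → Bool) → ℤ → Prop) : ℝ :=
  ∑ x : Fin N → Bool, ∑ k ∈ noiseRange A β γ,
    if F x k then inputProb p x * noiseProb A β γ k else 0

/-- Conditional probability of `F` given `G`. -/
def condProb (A β γ : ℝ) {N : ℕ} (p : Fin N → ℝ) (F G : (Fin N → Bool) → ℤ → Prop) : ℝ :=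
  prob A β γ p (fun x k => F x k ∧ G x k) / prob A β γ p G

/-- `α_i`, the probability that noise bit `i` equals one. -/
def alpha (A β γ : ℝ) {N : ℕ} (i : Fin N) : ℝ :=
  ∑ k ∈ (noiseRange A β γ).filter (fun k => noiseBit N k i = true), noiseProb A β γ k

/-- `θ_i`: probability that the higher outputs lie in `T i` given `(X_i, Z_i) = (0, 0)`. -/
def theta (A β γ : ℝ) {N q : ℕ} (T : Fin N → Finset (Fin q → Bool)) (p : Fin N → ℝ)
    (i : Fin N) : ℝ :=
  condProb A β γ p (fun x k => upper q (output x k) i ∈ T i)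
    (fun x k => x i = false ∧ noiseBit N k i = false)

/-- `θ̄_i`: probability that the higher outputs lie in `T i` given `(X_i, Z_i) = (1, 1)`. -/
def thetaBar (A β γ : ℝ) {N q : ℕ} (T : Fin N → Finset (Fin q → Bool)) (p : Fin N → ℝ)
    (i : Fin N) : ℝ :=
  condProb A β γ p (fun x k => upper q (output x k) i ∈ T i)
    (fun x k => x i = true ∧ noiseBit N k i = true)

/-- Crossover probability from `0` to `1`. -/
def alphaZero (A β γ : ℝ) {N q : ℕ} (T : Fin N → Finset (Fin q → Bool)) (p : Fin N → ℝ)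
    (i : Fin N) : ℝ :=
  alpha A β γ i + (1 - alpha A β γ i) * theta A β γ T p i

/-- Crossover probability from `1` to `0`. -/
def alphaOne (A β γ : ℝ) {N q : ℕ} (T : Fin N → Finset (Fin q → Bool)) (p : Fin N → ℝ)
    (i : Fin N) : ℝ :=
  alpha A β γ i - alpha A β γ i * thetaBar A β γ T p i

/-- Binary entropy function in bits. -/
def hBin (x : ℝ) : ℝ := Real.binEntropy x / Real.log 2

/-- The rate term `Φ_i` of bit-pipe `i`. -/
def Phi (A β γ : ℝ) {N q : ℕ} (T : Fin N → Finset (Fin q → Bool)) (p : Fin N → ℝ)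
    (i : Fin N) : ℝ :=
  hBin ((1 - p i) * alphaZero A β γ T p i + p i * (1 - alphaOne A β γ T p i))
    - (1 - p i) * hBin (alphaZero A β γ T p i) - p i * hBin (alphaOne A β γ T p i)

/-- The flipped output of bit-pipe `i` in one unerased channel use. -/
def flippedOutput {N q : ℕ} (T : Fin N → Finset (Fin q → Bool)) (i : Fin N)
    (x : Fin N → Bool) (k : ℤ) : Bool :=
  flipped (T i) (output x k) (carry x k i) i

/-- Mutual information, in bits, of two binary variables with joint probability function `J`. -/
def mutualInfo (J : Bool → Bool → ℝ) : ℝ :=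
  ∑ a : Bool, ∑ b : Bool, J a b * Real.logb 2 (J a b / ((∑ b', J a b') * ∑ a', J a' b))

/-! ### Input parameters and codes -/

/-- Admissible Bernoulli parameters. The bit-pipes with `0 < p i` are the active ones. -/
def Feasible (A E γ : ℝ) {N : ℕ} (p : Fin N → ℝ) : Prop :=
  (∀ i, 0 ≤ p i ∧ p i ≤ 1) ∧
  (∑ i ∈ Finset.univ.filter (fun i => 0 < p i), (2 : ℝ) ^ (i : ℕ)) ≤ γ * A ∧
  (∑ i ∈ Finset.univ.filter (fun i => 0 < p i), p i * (2 : ℝ) ^ (i : ℕ)) ≤ γ * E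

/-- A separate binary block code of length `n` for each of `N` bit-pipes; each bit-pipe decoder
sees `n` symbols, each a bit or an erasure. -/
structure Code (N n : ℕ) where
  size : Fin N → ℕ
  size_pos : ∀ i, 0 < size i
  enc : (i : Fin N) → Fin (size i) → Fin n → Bool
  dec : (i : Fin N) → (Fin n → Option Bool) → Fin (size i)

namespace Code

variable {N n : ℕ}

/-- Input vector of the channel at time `t` for the message tuple `m`. -/
def input (C : Code N n) (m : (i : Fin N) → Fin (C.size i)) (t : Fin n) : Fin N → Bool :=
  fun i => C.enc i (m i) t

/-- Transmitted intensity at time `t` for the message tuple `m`. -/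
def intensity (C : Code N n) (γ : ℝ) (m : (i : Fin N) → Fin (C.size i)) (t : Fin n) : ℝ :=
  (∑ i : Fin N, if C.input m t i then (2 : ℝ) ^ (i : ℕ) else 0) / γ

/-- Every transmitted block obeys the peak constraint `A` and the average constraint `E`. -/
def MeetsConstraints (C : Code N n) (A E γ : ℝ) : Prop :=
  ∀ m : (i : Fin N) → Fin (C.size i),
    (∀ t, C.intensity γ m t ≤ A) ∧ ∑ t, C.intensity γ m t ≤ n * E

/-- The bit-pipes with `p i = 0` carry no message and always send zero. -/
def RespectsOff (C : Code N n) (p : Fin N → ℝ) : Prop :=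
  ∀ i, p i = 0 → C.size i = 1 ∧ ∀ m t, C.enc i m t = false

/-- The sequence handed to the decoder of bit-pipe `i`, when the carry bits that enter this
bit-pipe are believed to be `w`. -/
def decoderInput {q : ℕ} (T : Fin N → Finset (Fin q → Bool)) (y : Fin n → Option (Fin N → Bool))
    (w : Fin n → Bool) (i : Fin N) : Fin n → Option Bool :=
  fun t => (y t).map (fun v => flipped (T i) v (w t) i)

/-- The carry bits entering bit-pipe `i` as the receiver reconstructs them: after decoding a
bit-pipe it re-encodes the decision, deduces the noise bit and computes the next carry bit
(at erased times the value is immaterial). -/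
def carryEst {q : ℕ} (C : Code N n) (T : Fin N → Finset (Fin q → Bool))
    (y : Fin n → Option (Fin N → Bool)) : ℕ → Fin n → Bool
  | 0 => fun _ => false
  | i + 1 => fun t =>
      if h : i < N then
        match y t with
        | none => false
        | some v =>
            let w : Bool := carryEst C T y i t
            let x : Bool :=
              C.enc ⟨i, h⟩ (C.dec ⟨i, h⟩ (decoderInput T y (carryEst C T y i) ⟨i, h⟩)) t
            carryOut x (xor (xor (v ⟨i, h⟩) x) w) w
      else false

/-- Decision of the successive receiver about the message of bit-pipe `i`. -/
def decide {q : ℕ} (C : Code N n) (T : Fin N → Finset (Fin q → Bool))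
    (y : Fin n → Option (Fin N → Bool)) (i : Fin N) : Fin (C.size i) :=
  C.dec i (decoderInput T y (C.carryEst T y i) i)

/-- Probability that at least one message is decoded wrongly, for independent uniform messages
and `n` independent uses of the channel. -/
def errorProb {q : ℕ} (C : Code N n) (A β γ ε : ℝ) (T : Fin N → Finset (Fin q → Bool)) : ℝ :=
  (∑ m : (i : Fin N) → Fin (C.size i), ∑ y : Fin n → Option (Fin N → Bool),
    if C.decide T y = m then 0 else ∏ t, transProb A β γ ε (C.input m t) (y t)) /
    ∏ i, (C.size i : ℝ)

/-- Total rate in bits per channel use. -/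
def rate (C : Code N n) : ℝ := (∑ i, Real.logb 2 (C.size i)) / n

end Code

/-- The scheme with flipping sets `T` and active bit-pipes given by `p` achieves the rate `R` over
the channel with erasure probability `ε`: every smaller rate is attained, for all large block
lengths, with error probability as small as desired. -/
def Achieves (A E β γ ε : ℝ) {N q : ℕ} (T : Fin N → Finset (Fin q → Bool)) (p : Fin N → ℝ)
    (R : ℝ) : Prop :=
  ∀ R' < R, ∀ δ > 0, ∃ n₀ : ℕ, ∀ n ≥ n₀, ∃ C : Code N n,
    C.RespectsOff p ∧ C.MeetsConstraints A E γ ∧ R' ≤ C.rate ∧ C.errorProb A β γ ε T ≤ δ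

end CDBAC

end

namespace CDBAC

/-! ### Finite product laws -/

/-! The proof is a random coding argument for a genie-aided receiver that is always given the true
carry bits. For such a receiver, once the codewords are independent and Bernoulli, bit-pipe `i` is a
memoryless binary channel with erasures: the bits of the other pipes act as noise, and the
information between `X_i` and the observed symbol is `(1 - ε) Φ_i`. No joint treatment of the pipes
is needed beyond a union bound. If all genie-aided decoders are right, induction over the pipes
shows that the actual receiver reconstructs every carry bit it uses and makes the same decisions
(`carryEst_eq`, `decide_eq`). Its error event is thus contained in the genie's, and error
propagation costs nothing.

The power constraint must hold for every codeword. Codewords are therefore drawn from a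
Bernoulli(`p'`) law conditioned on weight at most `n p`, with `p' < p` on the active pipes
(`exists_codeword_law`). The conditioning event has probability at least 1/2 for long blocks, so the
conditioned law is at most twice the i.i.d. one. At most `N + 1` codewords enter any error event,
and a factor `2 ^ (N + 1)` is harmless against exponentially small errors (`exists_threshold_test`,
`exists_codebook`). The peak constraint holds because inactive pipes are silent.

It remains to let `p' = τ p` tend to the maximizer `p`. The quotients `θ_i` can jump at null events,
but `Φ_i` is a mutual information of probabilities polynomial in `p`, hence continuous on the cube
(`Phi_eq_mutualInfo`, `continuousOn_Phi`). The same continuity gives the maximum, the feasible set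
being compact (`isCompact_feasible`). The maximum is nonnegative, so an erasure probability below
the bound `epsBar β` can only help. -/

open Classical in
/-- Marginal of a product law along an injective selection of coordinates. -/
lemma sum_prod_comp_injective {ι κ X : Type*} [Fintype ι] [Fintype κ] [Fintype X]
    [DecidableEq ι] [DecidableEq κ]
    (w : ι → X → ℝ) (hw : ∀ a, ∑ x, w a x = 1) (σ : κ → ι) (hσ : Function.Injective σ)
    (F : (κ → X) → ℝ) :
    ∑ f : ι → X, (∏ a, w a (f a)) * F (fun k => f (σ k)) =
      ∑ g : κ → X, (∏ k, w (σ k) (g k)) * F g := by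
  have key : ∀ g : κ → X, ∑ f : ι → X with (fun k => f (σ k)) = g, ∏ a, w a (f a) =
      ∏ k, w (σ k) (g k) := by
    intro g
    -- The fibre over `g` is a box: coordinate `σ k` is pinned to `g k` and the others are free. Its
    -- mass factors, and the free coordinates contribute 1.
    have hset : (Finset.univ.filter fun f : ι → X => (fun k => f (σ k)) = g) =
        Fintype.piFinset (fun a => Finset.univ.filter fun x => ∀ k, σ k = a → x = g k) := by
      ext f
      simp only [Finset.mem_filter, Finset.mem_univ, true_and, Fintype.mem_piFinset]
      constructor
      · rintro rfl a k rfl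
        rfl
      · intro h
        funext k
        exact h (σ k) k rfl
    rw [hset, ← Finset.prod_univ_sum, ← Finset.prod_subset (Finset.subset_univ
      (Finset.univ.image σ)), Finset.prod_image hσ.injOn]
    · refine Finset.prod_congr rfl fun k _ => ?_
      have : (Finset.univ.filter fun x => ∀ k', σ k' = σ k → x = g k') = {g k} := by
        ext x
        simp only [Finset.mem_filter, Finset.mem_univ, true_and, Finset.mem_singleton]
        constructor
        · intro h
          exact h k rfl
        · rintro rfl k' hk'
          rw [hσ hk']
      rw [this, Finset.sum_singleton]
    · intro a _ ha
      rw [← hw a]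
      congr 1
      refine Finset.filter_true_of_mem fun x _ k hk => ?_
      exact absurd (Finset.mem_image.2 ⟨k, Finset.mem_univ _, hk⟩) ha
  rw [← Finset.sum_fiberwise Finset.univ (fun f : ι → X => fun k => f (σ k))]
  refine Finset.sum_congr rfl fun g _ => ?_
  rw [← key g, Finset.sum_mul]
  refine Finset.sum_congr rfl fun f hf => ?_
  rw [(Finset.mem_filter.1 hf).2]

/-- Image of an independent and identically distributed family under a letterwise map. -/
lemma sum_prod_comp_map {ι S R : Type*} [Fintype ι] [Fintype S] [Fintype R]
    [DecidableEq ι] [DecidableEq R]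
    (μ : S → ℝ) (φ : S → R) (F : (ι → R) → ℝ) :
    ∑ s : ι → S, (∏ t, μ (s t)) * F (fun t => φ (s t)) =
      ∑ r : ι → R, (∏ t, ∑ s with φ s = r t, μ s) * F r := by
  rw [← Finset.sum_fiberwise Finset.univ (fun s : ι → S => fun t => φ (s t))]
  refine Finset.sum_congr rfl fun r _ => ?_
  have hset : (Finset.univ.filter fun s : ι → S => (fun t => φ (s t)) = r) =
      Fintype.piFinset (fun t => Finset.univ.filter fun s => φ s = r t) := by
    ext s
    simp [funext_iff]
  rw [Finset.prod_univ_sum, ← hset, Finset.sum_mul]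
  refine Finset.sum_congr rfl fun s hs => ?_
  rw [(Finset.mem_filter.1 hs).2]

/-- An independent and identically distributed family has total mass one. -/
lemma sum_prod_eq_one {ι S : Type*} [Fintype ι] [DecidableEq ι] [Fintype S] (μ : S → ℝ)
    (hμ : ∑ s, μ s = 1) : ∑ s : ι → S, ∏ t, μ (s t) = 1 := by
  rw [← Fintype.piFinset_univ, ← Finset.prod_univ_sum]
  simp [hμ]

/-! ### Exponential bounds and the likelihood-ratio test -/

open Classical in
/-- Chernoff bound for the lower tail of a sum of independent variables. -/
lemma exists_chernoff {R : Type*} [Fintype R] (ν ℓ : R → ℝ) (h0 : ∀ r, 0 ≤ ν r)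
    (h1 : ∑ r, ν r = 1) {c : ℝ} (hc : c < ∑ r, ν r * ℓ r) :
    ∃ ρ : ℝ, 0 ≤ ρ ∧ ρ < 1 ∧ ∀ n : ℕ, ∑ r : Fin n → R,
      (if ∑ t, ℓ (r t) ≤ n * c then ∏ t, ν (r t) else 0) ≤ ρ ^ n := by
  -- `G` is the exponential moment of `c - ℓ`. Since `G 0 = 1` and `G' 0 < 0`, some `s > 0` has `G s
  -- < 1`, and this value serves as `ρ`.
  set G : ℝ → ℝ := fun s => ∑ r, ν r * Real.exp (s * (c - ℓ r)) with hG
  have hd : HasDerivAt G (c - ∑ r, ν r * ℓ r) 0 := by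
    have : ∀ r ∈ (Finset.univ : Finset R), HasDerivAt
        (fun s : ℝ => ν r * Real.exp (s * (c - ℓ r))) (ν r * (c - ℓ r)) 0 := by
      intro r _
      have h := (((hasDerivAt_id (0 : ℝ)).mul_const (c - ℓ r)).exp).const_mul (ν r)
      simpa using h
    have e : c - ∑ r, ν r * ℓ r = ∑ r, ν r * (c - ℓ r) := by
      simp only [mul_sub, Finset.sum_sub_distrib, ← Finset.sum_mul, h1, one_mul]
    rw [e]
    exact HasDerivAt.fun_sum this
  have hG0 : G 0 = 1 := by simp [hG, h1]
  have hneg : c - ∑ r, ν r * ℓ r < 0 := by linarith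
  obtain ⟨s, hs, hGs⟩ : ∃ s : ℝ, 0 < s ∧ G s < 1 := by
    have h := hd.hasDerivWithinAt (s := Set.Ioi 0)
    rw [hasDerivWithinAt_iff_tendsto_slope' (by simp)] at h
    have h2 := (h.eventually (gt_mem_nhds hneg)).and self_mem_nhdsWithin
    obtain ⟨s, hs, hs0⟩ := h2.exists
    refine ⟨s, hs0, ?_⟩
    rw [slope_def_field, hG0, sub_zero] at hs
    have hs0' : 0 < s := hs0
    rw [div_lt_iff₀ hs0'] at hs
    linarith
  refine ⟨G s, Finset.sum_nonneg fun r _ => mul_nonneg (h0 r) (Real.exp_pos _).le, hGs, ?_⟩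
  intro n
  have : G s ^ n = ∑ r : Fin n → R, ∏ t, (ν (r t) * Real.exp (s * (c - ℓ (r t)))) := by
    rw [← Fintype.piFinset_univ, ← Finset.prod_univ_sum (fun _ : Fin n => (Finset.univ : Finset R))
      (fun _ r => ν r * Real.exp (s * (c - ℓ r)))]
    simp [hG]
  rw [this]
  refine Finset.sum_le_sum fun r _ => ?_
  have hν : 0 ≤ ∏ t, ν (r t) := Finset.prod_nonneg fun t _ => h0 _
  rw [Finset.prod_mul_distrib, ← Real.exp_sum]
  split_ifs with h
  · refine le_mul_of_one_le_right hν (Real.one_le_exp ?_)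
    rw [← Finset.mul_sum, Finset.sum_sub_distrib]
    simp only [Finset.sum_const, Finset.card_univ, Fintype.card_fin, nsmul_eq_mul]
    exact mul_nonneg hs.le (by linarith)
  · exact mul_nonneg hν (Real.exp_pos _).le

open Classical in
/-- Threshold test between a law `J` and a reference weight `B`, with exponentially small errors. -/
lemma exists_threshold_test {R : Type*} [Fintype R] (J B : R → ℝ) (hJ : ∀ r, 0 ≤ J r)
    (hJ1 : ∑ r, J r = 1) (hB : ∀ r, 0 ≤ B r) (hJB : ∀ r, B r = 0 → J r = 0) {c : ℝ}
    (hc : c < ∑ r, J r * Real.log (J r / B r)) :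
    ∃ ρ : ℝ, 0 ≤ ρ ∧ ρ < 1 ∧ ∀ n : ℕ, ∃ D : (Fin n → R) → Prop,
      ∑ r : Fin n → R, (∏ t, J (r t)) * (if D r then 0 else 1) ≤ ρ ^ n ∧
      ∑ r : Fin n → R, (∏ t, B (r t)) * (if D r then 1 else 0) ≤ Real.exp (-(n * c)) := by
  obtain ⟨ρ, h0, h1, H⟩ := exists_chernoff J (fun r => Real.log (J r / B r)) hJ hJ1 hc
  -- Likelihood-ratio test. Rejection under `J` is a lower-tail event for the sum of the
  -- log-likelihood ratios, whose mean exceeds `c`. Acceptance under `B` is bounded by change of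
  -- measure, because there `B` is at most `exp (-n c)` times `J`.
  refine ⟨ρ, h0, h1, fun n => ⟨fun r => Real.exp (n * c) * ∏ t, B (r t) ≤ ∏ t, J (r t), ?_, ?_⟩⟩
  · refine le_trans (Finset.sum_le_sum fun r _ => ?_) (H n)
    have hnn : 0 ≤ ∏ t, J (r t) := Finset.prod_nonneg fun t _ => hJ _
    by_cases hD : Real.exp (n * c) * ∏ t, B (r t) ≤ ∏ t, J (r t)
    · simp only [hD, if_true, mul_zero]
      split_ifs <;> simp [hnn]
    · simp only [hD, if_false, mul_one]
      by_cases hz : ∏ t, J (r t) = 0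
      · simp [hz]
      · have hJp : ∀ t, 0 < J (r t) := fun t =>
          lt_of_le_of_ne (hJ _) fun h => hz (Finset.prod_eq_zero (Finset.mem_univ t) h.symm)
        have hBp : ∀ t, 0 < B (r t) := fun t =>
          lt_of_le_of_ne (hB _) fun h => (hJp t).ne' (hJB _ h.symm)
        rw [if_pos]
        have hpB : 0 < ∏ t, B (r t) := Finset.prod_pos fun t _ => hBp t
        rw [← Real.log_prod fun t _ => (div_pos (hJp t) (hBp t)).ne', Finset.prod_div_distrib,
          Real.log_le_iff_le_exp (div_pos (Finset.prod_pos fun t _ => hJp t) hpB),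
          div_le_iff₀ hpB]
        exact (not_le.1 hD).le
  · have hE : ∑ r : Fin n → R, ∏ t, J (r t) = 1 := sum_prod_eq_one J hJ1
    suffices hs : ∑ r : Fin n → R, (∏ t, B (r t)) *
        (if Real.exp (n * c) * ∏ t, B (r t) ≤ ∏ t, J (r t) then 1 else 0) ≤
        ∑ r : Fin n → R, Real.exp (-(n * c)) * ∏ t, J (r t) by
      rwa [← Finset.mul_sum, hE, mul_one] at hs
    refine Finset.sum_le_sum fun r _ => ?_
    split_ifs with h
    · rw [mul_one, Real.exp_neg, inv_mul_eq_div, le_div_iff₀ (Real.exp_pos _)]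
      linarith
    · rw [mul_zero]
      exact mul_nonneg (Real.exp_pos _).le (Finset.prod_nonneg fun t _ => hJ _)

/-! ### Random coding for a vector channel with separate bit-pipes -/

/-- Probability function of a Bernoulli variable. -/
noncomputable def bern (p : ℝ) (b : Bool) : ℝ := if b then p else 1 - p

lemma bern_nonneg {p : ℝ} (h0 : 0 ≤ p) (h1 : p ≤ 1) (b : Bool) : 0 ≤ bern p b := by
  unfold bern
  split_ifs <;> linarith

lemma sum_bern (p : ℝ) : ∑ b, bern p b = 1 := by
  simp [bern]

lemma inputProb_eq {N : ℕ} (p : Fin N → ℝ) (x : Fin N → Bool) :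
    inputProb p x = ∏ i, bern (p i) (x i) := rfl

lemma inputProb_nonneg {N : ℕ} {p : Fin N → ℝ} (hp : ∀ i, 0 ≤ p i ∧ p i ≤ 1)
    (x : Fin N → Bool) : 0 ≤ inputProb p x :=
  Finset.prod_nonneg fun i _ => bern_nonneg (hp i).1 (hp i).2 _

open Classical in
/-- Marginals of independent Bernoulli bits. -/
lemma sum_inputProb_filter {N : ℕ} (p : Fin N → ℝ) (i : Fin N) (a : Bool) :
    ∑ x : Fin N → Bool with x i = a, inputProb p x = bern (p i) a := by
  have h := sum_prod_comp_injective (fun j => bern (p j)) (fun j => sum_bern _)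
    (fun _ : Unit => i) (fun _ _ _ => rfl) (fun x => if x () = a then 1 else 0)
  simp only [mul_ite, mul_one, mul_zero, Finset.univ_unique, Finset.prod_singleton] at h
  rw [Finset.sum_filter]
  refine h.trans ?_
  rw [← Equiv.sum_comp (Equiv.funUnique Unit Bool).symm]
  simp

lemma sum_inputProb {N : ℕ} (p : Fin N → ℝ) : ∑ x : Fin N → Bool, inputProb p x = 1 := by
  simp only [inputProb_eq]
  rw [← Fintype.piFinset_univ, ← Finset.prod_univ_sum]
  simp only [sum_bern, Finset.prod_const_one]

/-! ### Codeword laws of bounded weight -/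

open Classical in
/-- A codeword law with bounded weight that is dominated by twice the Bernoulli law. -/
lemma exists_codeword_law {p' p : ℝ} (h0 : 0 ≤ p') (h1 : p' ≤ 1)
    (hp : p' < p ∨ p' = 0 ∧ 0 ≤ p) :
    ∃ n₀ : ℕ, ∀ n ≥ n₀, ∃ w : (Fin n → Bool) → ℝ, (∀ x, 0 ≤ w x) ∧ ∑ x, w x = 1 ∧
      (∀ x, 0 < w x → ∑ t, (if x t then (1 : ℝ) else 0) ≤ n * p) ∧
      ∀ x, w x ≤ 2 * ∏ t, bern p' (x t) := by
  -- Conditioning divides the Bernoulli law by the mass of the weight event, so mass at least 1/2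
  -- gives the factor 2.
  suffices h : ∃ n₀ : ℕ, ∀ n ≥ n₀, 1 / 2 ≤ ∑ x : Fin n → Bool,
      if ∑ t, (if x t then (1 : ℝ) else 0) ≤ n * p then ∏ t, bern p' (x t) else 0 by
    obtain ⟨n₀, h⟩ := h
    refine ⟨n₀, fun n hn => ?_⟩
    have hc := h n hn
    set c := ∑ x : Fin n → Bool,
      if ∑ t, (if x t then (1 : ℝ) else 0) ≤ n * p then ∏ t, bern p' (x t) else 0 with hcdef
    have hc0 : 0 < c := by linarith
    have hnn : ∀ x : Fin n → Bool, 0 ≤ ∏ t, bern p' (x t) := fun x =>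
      Finset.prod_nonneg fun t _ => bern_nonneg h0 h1 _
    refine ⟨fun x => (if ∑ t, (if x t then (1 : ℝ) else 0) ≤ n * p then
      ∏ t, bern p' (x t) else 0) / c, fun x => ?_, ?_, fun x hx => ?_, fun x => ?_⟩
    · refine div_nonneg ?_ hc0.le
      split_ifs
      exacts [hnn x, le_rfl]
    · rw [← Finset.sum_div, ← hcdef, div_self hc0.ne']
    · by_contra hcon
      simp only [hcon, if_false, zero_div, lt_irrefl] at hx
    · rw [div_le_iff₀ hc0]
      have := hnn x
      split_ifs <;> nlinarith
  rcases hp with hp | ⟨rfl, hp⟩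
  -- The sign change turns the upper tail of the weight into the lower tail covered by
  -- `exists_chernoff`.
  · obtain ⟨ρ, hρ0, hρ1, H⟩ := exists_chernoff (bern p') (fun b => if b then -1 else 0)
      (bern_nonneg h0 h1) (sum_bern p') (c := -p) (by simp [bern, hp])
    obtain ⟨n₀, hn₀⟩ := exists_pow_lt_of_lt_one (show (0 : ℝ) < 1 / 2 by norm_num) hρ1
    refine ⟨n₀, fun n hn => ?_⟩
    have hle : ρ ^ n ≤ 1 / 2 := (pow_le_pow_of_le_one hρ0 hρ1.le hn).trans hn₀.le
    have htot : ∑ x : Fin n → Bool, ∏ t, bern p' (x t) = 1 := sum_prod_eq_one _ (sum_bern p')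
    have key : ∑ x : Fin n → Bool, ∏ t, bern p' (x t) ≤ (∑ x : Fin n → Bool,
        if ∑ t, (if x t then (1 : ℝ) else 0) ≤ n * p then ∏ t, bern p' (x t) else 0) +
        ∑ x : Fin n → Bool, (if ∑ t, (if x t then (-1 : ℝ) else 0) ≤ n * (-p) then
          ∏ t, bern p' (x t) else 0) := by
      rw [← Finset.sum_add_distrib]
      refine Finset.sum_le_sum fun x _ => ?_
      have hnn : 0 ≤ ∏ t, bern p' (x t) :=
        Finset.prod_nonneg fun t _ => bern_nonneg h0 h1 _
      have hs : ∑ t, (if x t then (-1 : ℝ) else 0) = -∑ t, (if x t then (1 : ℝ) else 0) := by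
        rw [← Finset.sum_neg_distrib]
        exact Finset.sum_congr rfl fun t _ => by split_ifs <;> simp
      rw [hs]
      split_ifs with ha hb hb
      · linarith
      · linarith
      · linarith
      · exact absurd (by linarith [not_le.1 ha]) hb
    have := H n
    linarith
  · refine ⟨0, fun n _ => ?_⟩
    refine le_trans ?_ (Finset.single_le_sum (fun x _ => ?_)
      (Finset.mem_univ (fun _ : Fin n => false)))
    · rw [if_pos (by simpa using by positivity)]
      simp [bern]
      norm_num
    · split_ifs
      exacts [Finset.prod_nonneg fun t _ => bern_nonneg le_rfl zero_le_one _, le_rfl]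

/-! ### Miss and false-alarm probabilities averaged over codebooks -/

section RandomCoding

variable {N : ℕ} {Y V : Type*} [Fintype Y] [Fintype V]

/-- Joint law of the inputs and the output of one use of the channel `W`. -/
noncomputable def useLaw (p : Fin N → ℝ) (W : (Fin N → Bool) → Y → ℝ)
    (s : (Fin N → Bool) × Y) : ℝ := inputProb p s.1 * W s.1 s.2

open Classical in
/-- Joint law of the input bit of bit-pipe `i` and the observation `g`. -/
noncomputable def pipeLaw (p : Fin N → ℝ) (W : (Fin N → Bool) → Y → ℝ)
    (g : (Fin N → Bool) → Y → V) (i : Fin N) (r : Bool × V) : ℝ :=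
  ∑ s : (Fin N → Bool) × Y with (s.1 i, g s.1 s.2) = r, useLaw p W s

open Classical in
/-- Law of the observation `g`. -/
noncomputable def obsLaw (p : Fin N → ℝ) (W : (Fin N → Bool) → Y → ℝ)
    (g : (Fin N → Bool) → Y → V) (v : V) : ℝ :=
  ∑ s : (Fin N → Bool) × Y with g s.1 s.2 = v, useLaw p W s

omit [Fintype Y] in
lemma useLaw_nonneg {p : Fin N → ℝ} (hp : ∀ i, 0 ≤ p i ∧ p i ≤ 1)
    {W : (Fin N → Bool) → Y → ℝ} (hW : ∀ x y, 0 ≤ W x y) (s : (Fin N → Bool) × Y) :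
    0 ≤ useLaw p W s :=
  mul_nonneg (inputProb_nonneg hp _) (hW _ _)

lemma sum_useLaw (p : Fin N → ℝ) {W : (Fin N → Bool) → Y → ℝ} (hW : ∀ x, ∑ y, W x y = 1) :
    ∑ s, useLaw p W s = 1 := by
  simp only [useLaw, Fintype.sum_prod_type, ← Finset.mul_sum, hW, mul_one, sum_inputProb]

/-- Interchange of bit-pipes and times. -/
lemma sum_codewords_eq_sum_useLaw (p : Fin N → ℝ) (W : (Fin N → Bool) → Y → ℝ) {n : ℕ}
    (G : (Fin n → (Fin N → Bool) × Y) → ℝ) :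
    ∑ x : Fin N → Fin n → Bool, (∏ j, ∏ t, bern (p j) (x j t)) *
      ∑ y : Fin n → Y, (∏ t, W (fun j => x j t) (y t)) * G (fun t => (fun j => x j t, y t)) =
    ∑ s : Fin n → (Fin N → Bool) × Y, (∏ t, useLaw p W (s t)) * G s := by
  rw [← Equiv.sum_comp (Equiv.arrowProdEquivProdArrow (Fin n) (fun _ => Fin N → Bool)
    (fun _ => Y)).symm, Fintype.sum_prod_type, ← Equiv.sum_comp (Equiv.piComm _)]
  refine Finset.sum_congr rfl fun x _ => ?_
  rw [Finset.mul_sum]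
  refine Finset.sum_congr rfl fun y _ => ?_
  rw [← mul_assoc]
  congr 1
  rw [Finset.prod_comm, ← Finset.prod_mul_distrib]
  rfl

open Classical in
/-- Expected probability that the transmitted codeword fails the test `D`. -/
lemma sum_codebooks_miss_le {p : Fin N → ℝ}
    {W : (Fin N → Bool) → Y → ℝ} (hW : ∀ x y, 0 ≤ W x y) (g : (Fin N → Bool) → Y → V)
    (i : Fin N) {n : ℕ} {w : Fin N → (Fin n → Bool) → ℝ} (hw0 : ∀ j x, 0 ≤ w j x)
    (hw1 : ∀ j, ∑ x, w j x = 1) (hw2 : ∀ j x, w j x ≤ 2 * ∏ t, bern (p j) (x t))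
    {M : Fin N → ℕ} (m : (j : Fin N) → Fin (M j)) (D : (Fin n → Bool × V) → Prop) :
    ∑ f : (Σ j, Fin (M j)) → Fin n → Bool, (∏ a, w a.1 (f a)) *
      ∑ y : Fin n → Y, (∏ t, W (fun j => f ⟨j, m j⟩ t) (y t)) *
        (if D (fun t => (f ⟨i, m i⟩ t, g (fun j => f ⟨j, m j⟩ t) (y t))) then 0 else 1) ≤
    2 ^ N * ∑ r : Fin n → Bool × V, (∏ t, pipeLaw p W g i (r t)) * (if D r then 0 else 1) := by
  have h := sum_prod_comp_injective (fun a : (Σ j, Fin (M j)) => w a.1) (fun a => hw1 a.1)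
    (fun j : Fin N => ⟨j, m j⟩) (fun j j' hjj' => congrArg Sigma.fst hjj')
    (fun x => ∑ y : Fin n → Y, (∏ t, W (fun j => x j t) (y t)) *
        (if D (fun t => (x i t, g (fun j => x j t) (y t))) then 0 else 1))
  refine h.le.trans ?_
  clear h
  have h2 := sum_prod_comp_map (ι := Fin n) (useLaw p W) (fun s => (s.1 i, g s.1 s.2))
    (fun r => if D r then (0 : ℝ) else 1)
  simp only [pipeLaw]
  rw [← h2, ← sum_codewords_eq_sum_useLaw p W
    (fun s => if D (fun t => ((s t).1 i, g (s t).1 (s t).2)) then (0 : ℝ) else 1), Finset.mul_sum]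
  refine Finset.sum_le_sum fun x _ => ?_
  rw [← mul_assoc]
  refine mul_le_mul_of_nonneg_right ?_ (Finset.sum_nonneg fun y _ => mul_nonneg
    (Finset.prod_nonneg fun t _ => hW _ _) (by split_ifs <;> simp))
  -- One factor 2 for each of the `N` transmitted codewords; the other codebook entries have been
  -- summed out.
  refine (Finset.prod_le_prod (fun j _ => hw0 _ _) fun j _ => hw2 j (x j)).trans ?_
  rw [Finset.prod_mul_distrib]
  simp

open Classical in
/-- Expected probability that a codeword other than the transmitted one passes the test `D`. -/
lemma sum_codebooks_falseAlarm_le {p : Fin N → ℝ}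
    {W : (Fin N → Bool) → Y → ℝ} (hW : ∀ x y, 0 ≤ W x y) (g : (Fin N → Bool) → Y → V)
    (i : Fin N) {n : ℕ} {w : Fin N → (Fin n → Bool) → ℝ} (hw0 : ∀ j x, 0 ≤ w j x)
    (hw1 : ∀ j, ∑ x, w j x = 1) (hw2 : ∀ j x, w j x ≤ 2 * ∏ t, bern (p j) (x t))
    {M : Fin N → ℕ} (m : (j : Fin N) → Fin (M j)) (m' : Fin (M i)) (hm : m' ≠ m i)
    (D : (Fin n → Bool × V) → Prop) :
    ∑ f : (Σ j, Fin (M j)) → Fin n → Bool, (∏ a, w a.1 (f a)) *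
      ∑ y : Fin n → Y, (∏ t, W (fun j => f ⟨j, m j⟩ t) (y t)) *
        (if D (fun t => (f ⟨i, m'⟩ t, g (fun j => f ⟨j, m j⟩ t) (y t))) then 1 else 0) ≤
    2 ^ (N + 1) * ∑ r : Fin n → Bool × V,
      (∏ t, (bern (p i) (r t).1 * obsLaw p W g (r t).2)) * (if D r then 1 else 0) := by
  -- Index `none` stands for the competing codeword and `some j` for the transmitted ones. As `m' ≠
  -- m i`, these are `N + 1` different codebook entries, so the competitor is independent of all
  -- that is observed.
  have h := sum_prod_comp_injective (fun a : (Σ j, Fin (M j)) => w a.1) (fun a => hw1 a.1)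
    (fun j : Option (Fin N) => j.elim (⟨i, m'⟩ : Σ j, Fin (M j)) fun j => ⟨j, m j⟩)
    (by
      rintro (_ | j) (_ | j') hjj'
      · rfl
      · simp only [Option.elim, Sigma.mk.injEq] at hjj'
        obtain ⟨rfl, hjj'⟩ := hjj'
        exact absurd (eq_of_heq hjj') hm
      · simp only [Option.elim, Sigma.mk.injEq] at hjj'
        obtain ⟨rfl, hjj'⟩ := hjj'
        exact absurd (eq_of_heq hjj').symm hm
      · exact congrArg some (congrArg Sigma.fst hjj'))
    (fun x => ∑ y : Fin n → Y, (∏ t, W (fun j => x (some j) t) (y t)) *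
        (if D (fun t => (x none t, g (fun j => x (some j) t) (y t))) then 1 else 0))
  refine h.le.trans ?_
  clear h
  rw [← Equiv.sum_comp (Equiv.piOptionEquivProd (β := fun _ => Fin n → Bool)).symm,
    Fintype.sum_prod_type]
  simp only [Fintype.prod_option]
  have hB : ∀ r : Bool × V, bern (p i) r.1 * obsLaw p W g r.2 =
      ∑ s : Bool × ((Fin N → Bool) × Y) with (s.1, g s.2.1 s.2.2) = r,
        bern (p i) s.1 * useLaw p W s.2 := by
    rintro ⟨a, v⟩
    simp only [obsLaw, Finset.sum_filter, Finset.mul_sum, Prod.mk.injEq]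
    symm
    rw [Fintype.sum_prod_type, Finset.sum_eq_single a]
    · simp
    · intro b _ hb
      simp [hb]
    · simp
  simp only [hB]
  have h2 := sum_prod_comp_map (ι := Fin n)
    (fun s : Bool × ((Fin N → Bool) × Y) => bern (p i) s.1 * useLaw p W s.2)
    (fun s => (s.1, g s.2.1 s.2.2)) (fun r => if D r then (1 : ℝ) else 0)
  rw [← h2, ← Equiv.sum_comp (Equiv.arrowProdEquivProdArrow (Fin n) (fun _ => Bool)
    (fun _ => (Fin N → Bool) × Y)).symm, Fintype.sum_prod_type, Finset.mul_sum]
  refine Finset.sum_le_sum fun x' _ => ?_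
  have h3 := sum_codewords_eq_sum_useLaw p W (n := n)
    (fun s => if D (fun t => (x' t, g (s t).1 (s t).2)) then (1 : ℝ) else 0)
  have h4 : ∑ s : Fin n → (Fin N → Bool) × Y, (∏ t, (bern (p i) (x' t) * useLaw p W (s t))) *
      (if D (fun t => (x' t, g (s t).1 (s t).2)) then (1 : ℝ) else 0) =
      (∏ t, bern (p i) (x' t)) * ∑ s : Fin n → (Fin N → Bool) × Y, (∏ t, useLaw p W (s t)) *
      (if D (fun t => (x' t, g (s t).1 (s t).2)) then (1 : ℝ) else 0) := by
    rw [Finset.mul_sum]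
    exact Finset.sum_congr rfl fun s _ => by rw [Finset.prod_mul_distrib, mul_assoc]
  refine le_of_le_of_eq ?_ (congrArg (2 ^ (N + 1) * ·) h4.symm)
  rw [← h3, Finset.mul_sum, Finset.mul_sum]
  refine Finset.sum_le_sum fun x _ => ?_
  rw [← mul_assoc, ← mul_assoc]
  refine mul_le_mul_of_nonneg_right ?_ (Finset.sum_nonneg fun y _ => mul_nonneg
    (Finset.prod_nonneg fun t _ => hW _ _) (by split_ifs <;> simp))
  have hx : ∏ j, w j (x j) ≤ 2 ^ N * ∏ j, ∏ t, bern (p j) (x j t) := by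
    refine (Finset.prod_le_prod (fun j _ => hw0 _ _) fun j _ => hw2 j (x j)).trans ?_
    rw [Finset.prod_mul_distrib]
    simp
  refine (mul_le_mul (hw2 i x') hx (Finset.prod_nonneg fun j _ => hw0 _ _)
    ((hw0 _ _).trans (hw2 i x'))).trans (le_of_eq ?_)
  ring

end RandomCoding
-- Decoding by tests, union bound and choice of a codebook
section RandomCoding

variable {N : ℕ} {Y V : Type*} [Fintype Y] [Fintype V]

omit [Fintype V] in
lemma pipeLaw_nonneg {p : Fin N → ℝ} (hp : ∀ i, 0 ≤ p i ∧ p i ≤ 1)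
    {W : (Fin N → Bool) → Y → ℝ} (hW : ∀ x y, 0 ≤ W x y) (g : (Fin N → Bool) → Y → V)
    (i : Fin N) (r : Bool × V) : 0 ≤ pipeLaw p W g i r :=
  Finset.sum_nonneg fun s _ => useLaw_nonneg hp hW s

omit [Fintype V] in
lemma obsLaw_nonneg {p : Fin N → ℝ} (hp : ∀ i, 0 ≤ p i ∧ p i ≤ 1)
    {W : (Fin N → Bool) → Y → ℝ} (hW : ∀ x y, 0 ≤ W x y) (g : (Fin N → Bool) → Y → V)
    (v : V) : 0 ≤ obsLaw p W g v :=
  Finset.sum_nonneg fun s _ => useLaw_nonneg hp hW s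

lemma sum_pipeLaw (p : Fin N → ℝ) {W : (Fin N → Bool) → Y → ℝ} (hW : ∀ x, ∑ y, W x y = 1)
    (g : (Fin N → Bool) → Y → V) (i : Fin N) : ∑ r, pipeLaw p W g i r = 1 := by
  classical
  rw [← sum_useLaw p hW]
  exact Finset.sum_fiberwise _ _ _

-- Absolute continuity of the joint law with respect to the product of its marginals, as
-- `exists_threshold_test` requires.
open Classical in
omit [Fintype V] in
lemma pipeLaw_eq_zero {p : Fin N → ℝ} (hp : ∀ i, 0 ≤ p i ∧ p i ≤ 1)
    {W : (Fin N → Bool) → Y → ℝ} (hW : ∀ x y, 0 ≤ W x y) (g : (Fin N → Bool) → Y → V)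
    (i : Fin N) (r : Bool × V) (h : bern (p i) r.1 * obsLaw p W g r.2 = 0) :
    pipeLaw p W g i r = 0 := by
  rcases mul_eq_zero.1 h with h | h
  · refine Finset.sum_eq_zero fun s hs => ?_
    have hs' : s.1 i = r.1 := congrArg Prod.fst (Finset.mem_filter.1 hs).2
    rw [useLaw, inputProb_eq, Finset.prod_eq_zero (Finset.mem_univ i), zero_mul]
    rw [hs', h]
  · refine le_antisymm (le_of_le_of_eq ?_ h) (pipeLaw_nonneg hp hW g i r)
    refine Finset.sum_le_sum_of_subset_of_nonneg (fun s hs => ?_)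
      fun s _ _ => useLaw_nonneg hp hW s
    have hs' := congrArg Prod.snd (Finset.mem_filter.1 hs).2
    exact Finset.mem_filter.2 ⟨Finset.mem_univ _, hs'⟩

open Classical in
/-- Decoder that looks for the only message whose codeword passes the test `D`. -/
noncomputable def testDecoder {M n : ℕ} (hM : 0 < M) (D : (Fin n → Bool × V) → Prop)
    (enc : Fin M → Fin n → Bool) (v : Fin n → V) : Fin M :=
  if h : ∃ m, D (fun t => (enc m t, v t)) ∧ ∀ m', D (fun t => (enc m' t, v t)) → m' = m then
    h.choose else ⟨0, hM⟩

omit [Fintype V] in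
lemma testDecoder_eq {M n : ℕ} (hM : 0 < M) (D : (Fin n → Bool × V) → Prop)
    (enc : Fin M → Fin n → Bool) (v : Fin n → V) (m : Fin M) (h1 : D (fun t => (enc m t, v t)))
    (h2 : ∀ m', m' ≠ m → ¬ D (fun t => (enc m' t, v t))) : testDecoder hM D enc v = m := by
  have h : ∃ m, D (fun t => (enc m t, v t)) ∧ ∀ m', D (fun t => (enc m' t, v t)) → m' = m :=
    ⟨m, h1, fun m' hm' => by_contra fun hne => h2 m' hne hm'⟩
  rw [testDecoder, dif_pos h]
  exact (h.choose_spec.2 m h1).symm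

-- Union bound: a decoder errs only if the transmitted codeword fails its test or a competitor
-- passes it.
open Classical in
omit [Fintype V] in
lemma testDecoder_error_le {M : Fin N → ℕ} {n : ℕ} (hM : ∀ i, 0 < M i)
    (D : (i : Fin N) → (Fin n → Bool × V) → Prop)
    (enc : (i : Fin N) → Fin (M i) → Fin n → Bool) (v : Fin N → Fin n → V)
    (m : (i : Fin N) → Fin (M i)) :
    (if ∀ i, testDecoder (hM i) (D i) (enc i) (v i) = m i then (0 : ℝ) else 1) ≤
      ∑ i, ((if D i (fun t => (enc i (m i) t, v i t)) then 0 else 1) +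
        ∑ m' ∈ Finset.univ.erase (m i), if D i (fun t => (enc i m' t, v i t)) then 1 else 0) := by
  have hnn : ∀ i : Fin N, (0 : ℝ) ≤ ∑ m' ∈ Finset.univ.erase (m i),
      if D i (fun t => (enc i m' t, v i t)) then 1 else 0 := fun i =>
    Finset.sum_nonneg fun m' _ => by split_ifs <;> simp
  have hnn' : ∀ i : Fin N, (0 : ℝ) ≤ ((if D i (fun t => (enc i (m i) t, v i t)) then 0 else 1) +
        ∑ m' ∈ Finset.univ.erase (m i),
          if D i (fun t => (enc i m' t, v i t)) then 1 else 0) := fun i =>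
    add_nonneg (by split_ifs <;> simp) (hnn i)
  split_ifs with h
  · exact Finset.sum_nonneg fun i _ => hnn' i
  · obtain ⟨i, hi⟩ := not_forall.1 h
    refine le_trans ?_ (Finset.single_le_sum (fun i _ => hnn' i) (Finset.mem_univ i))
    by_cases hD : D i (fun t => (enc i (m i) t, v i t))
    · have : ∃ m', m' ≠ m i ∧ D i (fun t => (enc i m' t, v i t)) := by
        by_contra hcon
        push Not at hcon
        exact hi (testDecoder_eq (hM i) (D i) (enc i) (v i) (m i) hD hcon)
      obtain ⟨m', hm', hD'⟩ := this
      have h1 := Finset.single_le_sum (f := fun m' =>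
        if D i (fun t => (enc i m' t, v i t)) then (1 : ℝ) else 0)
        (fun m' _ => by split_ifs <;> simp)
        (Finset.mem_erase.2 ⟨hm', Finset.mem_univ m'⟩)
      simp only [hD', if_true] at h1
      simp only [hD, if_true, zero_add]
      exact h1
    · simp only [hD, if_false]
      linarith [hnn i]

open Classical in
/-- Expected number of decoding errors over random codebooks, for fixed tests. -/
lemma sum_codebooks_error_le {p : Fin N → ℝ}
    {W : (Fin N → Bool) → Y → ℝ} (hW : ∀ x y, 0 ≤ W x y)
    (g : Fin N → (Fin N → Bool) → Y → V)
    {n : ℕ} {w : Fin N → (Fin n → Bool) → ℝ} (hw0 : ∀ j x, 0 ≤ w j x)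
    (hw1 : ∀ j, ∑ x, w j x = 1) (hw2 : ∀ j x, w j x ≤ 2 * ∏ t, bern (p j) (x t))
    {M : Fin N → ℕ} (hM : ∀ i, 0 < M i) (D : (i : Fin N) → (Fin n → Bool × V) → Prop)
    {a b : Fin N → ℝ}
    (ha : ∀ i, ∑ r : Fin n → Bool × V, (∏ t, pipeLaw p W (g i) i (r t)) *
      (if D i r then 0 else 1) ≤ a i)
    (hb : ∀ i, ∑ r : Fin n → Bool × V, (∏ t, (bern (p i) (r t).1 * obsLaw p W (g i) (r t).2)) *
      (if D i r then 1 else 0) ≤ b i) :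
    ∑ f : (Σ j, Fin (M j)) → Fin n → Bool, (∏ c, w c.1 (f c)) *
      ∑ m : (i : Fin N) → Fin (M i), ∑ y : Fin n → Y,
        (∏ t, W (fun j => f ⟨j, m j⟩ t) (y t)) *
        (if ∀ i, testDecoder (hM i) (D i) (fun m' => f ⟨i, m'⟩)
          (fun t => g i (fun j => f ⟨j, m j⟩ t) (y t)) = m i then 0 else 1) ≤
      (∏ i, (M i : ℝ)) * ∑ i, (2 ^ N * a i + (M i - 1) * (2 ^ (N + 1) * b i)) := by
  calc
    _ ≤ ∑ f : (Σ j, Fin (M j)) → Fin n → Bool, (∏ c, w c.1 (f c)) *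
      ∑ m : (i : Fin N) → Fin (M i), ∑ y : Fin n → Y,
        (∏ t, W (fun j => f ⟨j, m j⟩ t) (y t)) *
        ∑ i, ((if D i (fun t => (f ⟨i, m i⟩ t, g i (fun j => f ⟨j, m j⟩ t) (y t))) then 0 else 1) +
        ∑ m' ∈ Finset.univ.erase (m i),
          if D i (fun t => (f ⟨i, m'⟩ t, g i (fun j => f ⟨j, m j⟩ t) (y t))) then 1 else 0) := by
      refine Finset.sum_le_sum fun f _ => mul_le_mul_of_nonneg_left
        (Finset.sum_le_sum fun m _ => Finset.sum_le_sum fun y _ => mul_le_mul_of_nonneg_left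
          ?_ (Finset.prod_nonneg fun t _ => hW _ _)) (Finset.prod_nonneg fun c _ => hw0 _ _)
      exact testDecoder_error_le hM D (fun i m' => f ⟨i, m'⟩)
        (fun i t => g i (fun j => f ⟨j, m j⟩ t) (y t)) m
    _ = ∑ m : (i : Fin N) → Fin (M i), ∑ i,
      ((∑ f : (Σ j, Fin (M j)) → Fin n → Bool, (∏ c, w c.1 (f c)) *
        ∑ y : Fin n → Y, (∏ t, W (fun j => f ⟨j, m j⟩ t) (y t)) *
        (if D i (fun t => (f ⟨i, m i⟩ t, g i (fun j => f ⟨j, m j⟩ t) (y t))) then 0 else 1)) +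
      ∑ m' ∈ Finset.univ.erase (m i), ∑ f : (Σ j, Fin (M j)) → Fin n → Bool,
        (∏ c, w c.1 (f c)) * ∑ y : Fin n → Y, (∏ t, W (fun j => f ⟨j, m j⟩ t) (y t)) *
        (if D i (fun t => (f ⟨i, m'⟩ t, g i (fun j => f ⟨j, m j⟩ t) (y t))) then 1 else 0)) := by
      simp only [Finset.mul_sum, mul_add, Finset.sum_add_distrib]
      have hcomm : ∀ F : ((Σ j, Fin (M j)) → Fin n → Bool) → ((i : Fin N) → Fin (M i)) →
          (Fin n → Y) → Fin N → ℝ,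
          ∑ f, ∑ m, ∑ y, ∑ i, F f m y i = ∑ m, ∑ i, ∑ f, ∑ y, F f m y i := by
        intro F
        rw [Finset.sum_comm]
        refine Finset.sum_congr rfl fun m _ => ?_
        exact (Finset.sum_congr rfl fun f _ => Finset.sum_comm).trans Finset.sum_comm
      rw [hcomm, hcomm]
      congr 1
      refine Finset.sum_congr rfl fun m _ => Finset.sum_congr rfl fun i _ => ?_
      rw [Finset.sum_comm]
      refine (Finset.sum_congr rfl fun y _ => Finset.sum_comm).trans ?_
      rw [Finset.sum_comm]
      refine Finset.sum_congr rfl fun m' _ => Finset.sum_comm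
    _ ≤ ∑ m : (i : Fin N) → Fin (M i), ∑ i,
        (2 ^ N * a i + (M i - 1) * (2 ^ (N + 1) * b i)) := by
      refine Finset.sum_le_sum fun m _ => Finset.sum_le_sum fun i _ => add_le_add ?_ ?_
      · exact (sum_codebooks_miss_le hW (g i) i hw0 hw1 hw2 m (D i)).trans
          (mul_le_mul_of_nonneg_left (ha i) (by positivity))
      · refine (Finset.sum_le_sum fun m' hm' => (sum_codebooks_falseAlarm_le hW (g i) i hw0 hw1
          hw2 m m' (Finset.ne_of_mem_erase hm') (D i)).trans
          (mul_le_mul_of_nonneg_left (hb i) (by positivity))).trans (le_of_eq ?_)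
        rw [Finset.sum_const, Finset.card_erase_of_mem (Finset.mem_univ _), Finset.card_univ,
          Fintype.card_fin, nsmul_eq_mul, Nat.cast_sub (hM i), Nat.cast_one]
    _ = _ := by
      rw [Finset.sum_const, Finset.card_univ, nsmul_eq_mul]
      simp [Fintype.card_pi]

open Classical in
/-- Random coding theorem for separate codes on the bit-pipes of a vector channel, with
constrained codeword weights: below mutual information, the error probability tends to zero. -/
lemma exists_codebook {p' p R : Fin N → ℝ} (hp' : ∀ i, 0 ≤ p' i ∧ p' i ≤ 1)
    (hp : ∀ i, p' i < p i ∨ p' i = 0 ∧ 0 ≤ p i)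
    {W : (Fin N → Bool) → Y → ℝ} (hW : ∀ x y, 0 ≤ W x y) (hW1 : ∀ x, ∑ y, W x y = 1)
    (g : Fin N → (Fin N → Bool) → Y → V)
    (hR : ∀ i, R i < ∑ r, pipeLaw p' W (g i) i r * Real.log (pipeLaw p' W (g i) i r /
      (bern (p' i) r.1 * obsLaw p' W (g i) r.2))) {δ : ℝ} (hδ : 0 < δ) :
    ∃ n₀ : ℕ, ∀ n ≥ n₀, ∀ M : Fin N → ℕ, (∀ i, 0 < M i) →
      (∀ i, (M i : ℝ) - 1 ≤ Real.exp (n * R i)) →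
      ∃ (enc : (i : Fin N) → Fin (M i) → Fin n → Bool)
        (dec : (i : Fin N) → (Fin n → V) → Fin (M i)),
        (∀ i m, ∑ t, (if enc i m t then (1 : ℝ) else 0) ≤ n * p i) ∧
        ∑ m : (i : Fin N) → Fin (M i), ∑ y : Fin n → Y,
          (∏ t, W (fun j => enc j (m j) t) (y t)) *
          (if ∀ i, dec i (fun t => g i (fun j => enc j (m j) t) (y t)) = m i then 0 else 1) ≤
          (∏ i, (M i : ℝ)) * δ := by
  set I : Fin N → ℝ := fun i => ∑ r, pipeLaw p' W (g i) i r * Real.log (pipeLaw p' W (g i) i r /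
      (bern (p' i) r.1 * obsLaw p' W (g i) r.2)) with hI
  -- With the threshold halfway between `R i` and `I i`, misses decay geometrically, and at most
  -- `exp (n R i)` competitors still leave a false-alarm term of order `exp (-n (I i - R i) / 2)`.
  have htest := fun i => exists_threshold_test (pipeLaw p' W (g i) i)
    (fun r => bern (p' i) r.1 * obsLaw p' W (g i) r.2) (pipeLaw_nonneg hp' hW (g i) i)
    (sum_pipeLaw p' hW1 (g i) i)
    (fun r => mul_nonneg (bern_nonneg (hp' i).1 (hp' i).2 _) (obsLaw_nonneg hp' hW (g i) _))
    (pipeLaw_eq_zero hp' hW (g i) i) (c := (R i + I i) / 2)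
    (show (R i + I i) / 2 < I i by have : R i < I i := hR i; linarith)
  choose ρ hρ0 hρ1 D hD1 hD2 using htest
  have hlaw := fun i => exists_codeword_law (hp' i).1 (hp' i).2 (hp i)
  choose n₁ hn₁ using hlaw
  have hlim : Filter.Tendsto (fun n : ℕ => ∑ i, (2 ^ N * ρ i ^ n +
      2 ^ (N + 1) * Real.exp (-((I i - R i) / 2)) ^ n)) Filter.atTop (nhds 0) := by
    have : ∀ i ∈ (Finset.univ : Finset (Fin N)), Filter.Tendsto (fun n : ℕ => 2 ^ N * ρ i ^ n +
        2 ^ (N + 1) * Real.exp (-((I i - R i) / 2)) ^ n) Filter.atTop (nhds 0) := by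
      intro i _
      have h1 := (tendsto_pow_atTop_nhds_zero_of_lt_one (hρ0 i) (hρ1 i)).const_mul ((2 : ℝ) ^ N)
      have hRi : R i < I i := hR i
      have h2 := (tendsto_pow_atTop_nhds_zero_of_lt_one
        (Real.exp_pos (-((I i - R i) / 2))).le (by rw [← Real.exp_zero]; exact Real.exp_lt_exp.2 (by linarith))).const_mul
        ((2 : ℝ) ^ (N + 1))
      simpa using h1.add h2
    simpa using tendsto_finsetSum _ this
  obtain ⟨n₂, hn₂⟩ := Filter.eventually_atTop.1 (hlim.eventually (gt_mem_nhds hδ))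
  refine ⟨n₂ + ∑ i, n₁ i, fun n hn M hM hMR => ?_⟩
  have hni : ∀ i, n₁ i ≤ n := fun i =>
    (Finset.single_le_sum (fun _ _ => Nat.zero_le _) (Finset.mem_univ i)).trans
      ((Nat.le_add_left _ _).trans hn)
  choose w hw0 hw1 hw2 hw3 using fun i => hn₁ i n (hni i)
  have key := sum_codebooks_error_le hW g hw0 hw1 hw3 hM (fun i => D i n)
    (fun i => hD1 i n) (fun i => hD2 i n)
  have hbound : ∑ i, (2 ^ N * ρ i ^ n +
      (M i - 1) * (2 ^ (N + 1) * Real.exp (-(n * ((R i + I i) / 2))))) ≤ δ := by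
    refine le_trans (Finset.sum_le_sum fun i _ => ?_)
      (hn₂ n ((Nat.le_add_right _ _).trans hn)).le
    refine add_le_add le_rfl ?_
    calc ((M i : ℝ) - 1) * (2 ^ (N + 1) * Real.exp (-(n * ((R i + I i) / 2))))
        ≤ Real.exp (n * R i) * (2 ^ (N + 1) * Real.exp (-(n * ((R i + I i) / 2)))) :=
          mul_le_mul_of_nonneg_right (hMR i) (by positivity)
      _ = 2 ^ (N + 1) * Real.exp (-((I i - R i) / 2)) ^ n := by
          rw [mul_left_comm, ← Real.exp_add, ← Real.exp_nat_mul]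
          congr 2
          ring
  have hMpos : 0 < ∏ i, (M i : ℝ) := Finset.prod_pos fun i _ => Nat.cast_pos.2 (hM i)
  have key2 := key.trans (mul_le_mul_of_nonneg_left hbound hMpos.le)
  have hone : ∑ f : (Σ j, Fin (M j)) → Fin n → Bool, (∏ c, w c.1 (f c)) = 1 := by
    rw [← Fintype.piFinset_univ, ← Finset.prod_univ_sum (fun _ => Finset.univ)
      (fun (c : Σ j, Fin (M j)) x => w c.1 x)]
    simp [hw1]
  -- Some codebook is no worse than the average. It has to be picked among those of positive
  -- probability, since only these are known to satisfy the weight bound.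
  obtain ⟨f, hf, hfle⟩ : ∃ f : (Σ j, Fin (M j)) → Fin n → Bool, 0 < ∏ c, w c.1 (f c) ∧
      ∑ m : (i : Fin N) → Fin (M i), ∑ y : Fin n → Y,
        (∏ t, W (fun j => f ⟨j, m j⟩ t) (y t)) *
        (if ∀ i, testDecoder (hM i) (D i n) (fun m' => f ⟨i, m'⟩)
          (fun t => g i (fun j => f ⟨j, m j⟩ t) (y t)) = m i then 0 else 1) ≤
          (∏ i, (M i : ℝ)) * δ := by
    by_contra hcon
    push Not at hcon
    refine absurd key2 (not_le.2 ?_)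
    refine lt_of_eq_of_lt (one_mul _).symm ?_
    refine lt_of_eq_of_lt (congrArg (· * ((∏ i, (M i : ℝ)) * δ)) hone.symm) ?_
    rw [Finset.sum_mul]
    have hnn : ∀ f : (Σ j, Fin (M j)) → Fin n → Bool, 0 ≤ ∏ c, w c.1 (f c) := fun f =>
      Finset.prod_nonneg fun c _ => hw0 _ _
    refine Finset.sum_lt_sum (fun f _ => ?_) ?_
    · rcases (hnn f).eq_or_lt with h | h
      · rw [← h, zero_mul, zero_mul]
      · exact mul_le_mul_of_nonneg_left (hcon f h).le h.le
    · obtain ⟨f, -, hf⟩ := Finset.exists_lt_of_sum_lt (s := Finset.univ)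
        (f := fun _ : (Σ j, Fin (M j)) → Fin n → Bool => (0 : ℝ))
        (g := fun f => ∏ c, w c.1 (f c)) (by rw [hone]; simp)
      exact ⟨f, Finset.mem_univ _, mul_lt_mul_of_pos_left (hcon f hf) hf⟩
  refine ⟨fun i m => f ⟨i, m⟩, fun i => testDecoder (hM i) (D i n) (fun m' => f ⟨i, m'⟩),
    fun i m => hw2 i _ ?_, hfle⟩
  refine lt_of_le_of_ne (hw0 _ _) fun h => hf.ne' ?_
  exact Finset.prod_eq_zero (Finset.mem_univ (⟨i, m⟩ : Σ j, Fin (M j))) h.symm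

end RandomCoding
/-! ### The quantized Gaussian noise -/

lemma integrable_gauss : MeasureTheory.Integrable fun u : ℝ => Real.exp (-u ^ 2 / 2) := by
  have h := integrable_exp_neg_mul_sq (show (0 : ℝ) < 1 / 2 by norm_num)
  refine h.congr (Filter.Eventually.of_forall fun u => ?_)
  simp only
  congr 1
  ring

lemma gaussQ_strictAnti : StrictAnti gaussQ := by
  intro a b hab
  have hs : (0 : ℝ) < 1 / Real.sqrt (2 * Real.pi) := by positivity
  refine mul_lt_mul_of_pos_left ?_ hs
  have h : (∫ u in Set.Ioi a, Real.exp (-u ^ 2 / 2)) =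
      (∫ u in Set.Ioc a b, Real.exp (-u ^ 2 / 2)) + ∫ u in Set.Ioi b, Real.exp (-u ^ 2 / 2) := by
    rw [← Set.Ioc_union_Ioi_eq_Ioi hab.le]
    exact MeasureTheory.setIntegral_union (Set.Ioc_disjoint_Ioi le_rfl) measurableSet_Ioi
      integrable_gauss.integrableOn integrable_gauss.integrableOn
  have hpos : 0 < ∫ u in Set.Ioc a b, Real.exp (-u ^ 2 / 2) := by
    rw [← intervalIntegral.integral_of_le hab.le]
    exact intervalIntegral.intervalIntegral_pos_of_pos
      integrable_gauss.intervalIntegrable (fun u => Real.exp_pos _) hab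
  linarith

lemma gaussQ_zero : gaussQ 0 = 1 / 2 := by
  have h := integral_gaussian_Ioi (1 / 2)
  have h2 : (∫ u in Set.Ioi (0 : ℝ), Real.exp (-u ^ 2 / 2)) = Real.sqrt (2 * Real.pi) / 2 := by
    rw [show 2 * Real.pi = Real.pi / (1 / 2) by ring, ← h]
    congr 1
    funext u
    congr 1
    ring
  rw [gaussQ, h2]
  have : Real.sqrt (2 * Real.pi) ≠ 0 := by positivity
  field_simp

lemma epsBar_lt_one {β : ℝ} (hβ : 0 < β) : epsBar β < 1 := by
  have := gaussQ_strictAnti hβ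
  rw [gaussQ_zero] at this
  rw [epsBar]
  linarith

section Noise

variable {A β γ : ℝ}

lemma noise_denom_pos (hA : 0 < A) (hβ : 0 < β) (hγ : 0 < γ) :
    0 < gaussQ ((-(⌈γ * A⌉ : ℝ) - γ * β) / γ) -
      gaussQ (((⌈γ * (A + 2 * β)⌉ : ℝ) - γ * β) / γ) := by
  have h1 : (0 : ℝ) < γ * A := by positivity
  have h2 : (0 : ℝ) < γ * (A + 2 * β) := by positivity
  have h3 := Int.le_ceil (γ * A)
  have h4 := Int.le_ceil (γ * (A + 2 * β))
  refine sub_pos.2 (gaussQ_strictAnti ?_)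
  rw [div_lt_div_iff_of_pos_right hγ]
  linarith

lemma noiseProb_nonneg (hA : 0 < A) (hβ : 0 < β) (hγ : 0 < γ) (k : ℤ) :
    0 ≤ noiseProb A β γ k := by
  refine div_nonneg (sub_nonneg.2 (gaussQ_strictAnti.antitone ?_)) (noise_denom_pos hA hβ hγ).le
  rw [div_le_div_iff_of_pos_right hγ]
  linarith

lemma sum_Ico_int_sub (f : ℤ → ℝ) {a b : ℤ} (hab : a ≤ b) :
    ∑ k ∈ Finset.Ico a b, (f k - f (k + 1)) = f a - f b := by
  induction b, hab using Int.leInduction with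
  | base => simp
  | succ b hab ih =>
    rw [← Finset.insert_Ico_right_eq_Ico_add_one hab, Finset.sum_insert (by simp), ih]
    ring

/-- The numerators telescope to the common denominator. -/
lemma sum_noiseProb (hA : 0 < A) (hβ : 0 < β) (hγ : 0 < γ) :
    ∑ k ∈ noiseRange A β γ, noiseProb A β γ k = 1 := by
  have hab : -⌈γ * A⌉ ≤ ⌈γ * (A + 2 * β)⌉ := by
    have h1 : 0 < ⌈γ * A⌉ := Int.ceil_pos.2 (by positivity)
    have h2 : 0 < ⌈γ * (A + 2 * β)⌉ := Int.ceil_pos.2 (by positivity)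
    omega
  have h := sum_Ico_int_sub (fun k : ℤ => gaussQ (((k : ℝ) - γ * β) / γ)) hab
  simp only [noiseProb, ← Finset.sum_div, noiseRange]
  push_cast at h
  rw [h, div_self]
  exact (noise_denom_pos hA hβ hγ).ne'

end Noise

/-! ### One unerased channel use -/

section Prob

variable {A β γ : ℝ} {N q : ℕ}

lemma prob_congr (p : Fin N → ℝ) {F G : (Fin N → Bool) → ℤ → Prop} (h : ∀ x k, F x k ↔ G x k) :
    prob A β γ p F = prob A β γ p G := by
  have : F = G := by
    funext x k
    exact propext (h x k)
  rw [this]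

lemma prob_mono (hA : 0 < A) (hβ : 0 < β) (hγ : 0 < γ) {p : Fin N → ℝ}
    (hp : ∀ i, 0 ≤ p i ∧ p i ≤ 1) {F G : (Fin N → Bool) → ℤ → Prop} (h : ∀ x k, F x k → G x k) :
    prob A β γ p F ≤ prob A β γ p G := by
  refine Finset.sum_le_sum fun x _ => Finset.sum_le_sum fun k _ => ?_
  have := mul_nonneg (inputProb_nonneg hp x) (noiseProb_nonneg hA hβ hγ k)
  split_ifs with h1 h2
  · exact le_rfl
  · exact absurd (h x k h1) h2
  · exact this
  · exact le_rfl

lemma prob_nonneg (hA : 0 < A) (hβ : 0 < β) (hγ : 0 < γ) {p : Fin N → ℝ}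
    (hp : ∀ i, 0 ≤ p i ∧ p i ≤ 1) (F : (Fin N → Bool) → ℤ → Prop) : 0 ≤ prob A β γ p F := by
  refine Finset.sum_nonneg fun x _ => Finset.sum_nonneg fun k _ => ?_
  have := mul_nonneg (inputProb_nonneg hp x) (noiseProb_nonneg hA hβ hγ k)
  split_ifs
  exacts [this, le_rfl]

lemma prob_add_of_iff (p : Fin N → ℝ) {F G H : (Fin N → Bool) → ℤ → Prop}
    (h : ∀ x k, H x k ↔ F x k ∨ G x k) (hd : ∀ x k, F x k → ¬ G x k) :
    prob A β γ p H = prob A β γ p F + prob A β γ p G := by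
  simp only [prob, ← Finset.sum_add_distrib]
  refine Finset.sum_congr rfl fun x _ => Finset.sum_congr rfl fun k _ => ?_
  have h1 := h x k
  have h2 := hd x k
  by_cases hF : F x k <;> by_cases hG : G x k <;> simp_all

open Classical in
/-- Independence of input and noise. -/
lemma prob_and (p : Fin N → ℝ) (F : (Fin N → Bool) → Prop) (G : ℤ → Prop) :
    prob A β γ p (fun x k => F x ∧ G k) =
      (∑ x : Fin N → Bool with F x, inputProb p x) *
        ∑ k ∈ (noiseRange A β γ).filter G, noiseProb A β γ k := by
  simp only [prob, Finset.sum_filter, Finset.sum_mul_sum]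
  refine Finset.sum_congr rfl fun x _ => Finset.sum_congr rfl fun k _ => ?_
  by_cases hF : F x <;> by_cases hG : G k <;> simp [hF, hG]

lemma prob_input (hA : 0 < A) (hβ : 0 < β) (hγ : 0 < γ) (p : Fin N → ℝ) (i : Fin N) (a : Bool) :
    prob A β γ p (fun x _ => x i = a) = bern (p i) a := by
  classical
  have h := prob_and (A := A) (β := β) (γ := γ) p (fun x => x i = a) (fun _ => True)
  simp only [and_true, Finset.filter_true, sum_noiseProb hA hβ hγ, mul_one] at h
  rw [h, ← sum_inputProb_filter]
  congr!

lemma prob_input_noise (hA : 0 < A) (hβ : 0 < β) (hγ : 0 < γ) (p : Fin N → ℝ) (i : Fin N)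
    (a b : Bool) : prob A β γ p (fun x k => x i = a ∧ noiseBit N k i = b) =
      bern (p i) a * bern (alpha A β γ i) b := by
  classical
  rw [prob_and p (fun x => x i = a) (fun k => noiseBit N k i = b), ← sum_inputProb_filter]
  have ht : ∑ k ∈ (noiseRange A β γ).filter (fun k => noiseBit N k i = true),
      noiseProb A β γ k = alpha A β γ i := by
    rw [alpha]
  congr 1
  · congr!
  · cases b
    · have h := Finset.sum_filter_add_sum_filter_not (noiseRange A β γ)
        (fun k => noiseBit N k i = true) (noiseProb A β γ)
      rw [ht, sum_noiseProb hA hβ hγ] at h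
      simp only [Bool.not_eq_true] at h
      simp only [bern]
      simp
      refine Eq.trans ?_ (eq_sub_of_add_eq' h)
      congr!
    · simp only [bern, if_true, ← ht]
      congr!

/-- When `G` is null both sides vanish, so the value given to the quotient is immaterial. This
spares later identities any case distinction on `p i` and `alpha`. -/
lemma condProb_mul_prob (hA : 0 < A) (hβ : 0 < β) (hγ : 0 < γ) {p : Fin N → ℝ}
    (hp : ∀ i, 0 ≤ p i ∧ p i ≤ 1) (F G : (Fin N → Bool) → ℤ → Prop) :
    condProb A β γ p F G * prob A β γ p G = prob A β γ p (fun x k => F x k ∧ G x k) := by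
  rw [condProb]
  by_cases h : prob A β γ p G = 0
  · rw [h, mul_zero]
    refine le_antisymm (prob_nonneg hA hβ hγ hp _) ?_
    rw [← h]
    exact prob_mono hA hβ hγ hp fun x k hxk => hxk.2
  · rw [div_mul_cancel₀ _ h]

/-- After removal of the carry bit, the flipped output sees only `x i` and the noise bit. -/
lemma flippedOutput_eq_true_iff (T : Fin N → Finset (Fin q → Bool)) (i : Fin N)
    (x : Fin N → Bool) (k : ℤ) : flippedOutput T i x k = true ↔
      xor (x i) (noiseBit N k i) = true ∨
        xor (x i) (noiseBit N k i) = false ∧ upper q (output x k) i ∈ T i := by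
  have h : xor (output x k i) (carry x k i) = xor (x i) (noiseBit N k i) := by
    rw [output, Bool.xor_assoc, Bool.xor_self, Bool.xor_false]
  rw [flippedOutput, flipped, h]
  cases xor (x i) (noiseBit N k i) <;> simp

/-- With input 0, the output 1 arises in two disjoint ways: the noise bit is 1, or it is 0 and the
flip occurs. -/
lemma prob_zero_true (hA : 0 < A) (hβ : 0 < β) (hγ : 0 < γ) {p : Fin N → ℝ}
    (hp : ∀ i, 0 ≤ p i ∧ p i ≤ 1) (T : Fin N → Finset (Fin q → Bool)) (i : Fin N) :
    prob A β γ p (fun x k => x i = false ∧ flippedOutput T i x k = true) =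
      (1 - p i) * alphaZero A β γ T p i := by
  rw [prob_add_of_iff p (F := fun x k => x i = false ∧ noiseBit N k i = true)
    (G := fun x k => upper q (output x k) i ∈ T i ∧ (x i = false ∧ noiseBit N k i = false)),
    prob_input_noise hA hβ hγ, ← condProb_mul_prob hA hβ hγ hp, prob_input_noise hA hβ hγ]
  · simp only [bern, alphaZero, theta]
    simp
    ring
  · intro x k
    rw [flippedOutput_eq_true_iff]
    cases x i <;> cases noiseBit N k i <;> simp
  · rintro x k ⟨-, h1⟩ ⟨-, -, h2⟩
    rw [h1] at h2
    cases h2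

/-- With input 1, the output 0 requires noise bit 1 and no flip, so the flipped part is subtracted
from the event that input and noise bit are both 1. -/
lemma prob_one_false (hA : 0 < A) (hβ : 0 < β) (hγ : 0 < γ) {p : Fin N → ℝ}
    (hp : ∀ i, 0 ≤ p i ∧ p i ≤ 1) (T : Fin N → Finset (Fin q → Bool)) (i : Fin N) :
    prob A β γ p (fun x k => x i = true ∧ flippedOutput T i x k = false) =
      p i * alphaOne A β γ T p i := by
  have h := prob_add_of_iff (A := A) (β := β) (γ := γ) p
    (F := fun x k => x i = true ∧ flippedOutput T i x k = false)
    (G := fun x k => upper q (output x k) i ∈ T i ∧ (x i = true ∧ noiseBit N k i = true))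
    (H := fun x k => x i = true ∧ noiseBit N k i = true) (by
      intro x k
      have := flippedOutput_eq_true_iff T i x k
      rw [← Bool.not_eq_true (flippedOutput T i x k), this]
      cases x i <;> cases noiseBit N k i <;> simp
      tauto) (by
      rintro x k ⟨h1, h2⟩ ⟨h3, h4, h5⟩
      have := (flippedOutput_eq_true_iff T i x k).2 (Or.inr ⟨by rw [h4, h5]; rfl, h3⟩)
      rw [this] at h2
      cases h2)
  rw [← condProb_mul_prob hA hβ hγ hp (fun x k => upper q (output x k) i ∈ T i),
    prob_input_noise hA hβ hγ] at h
  simp only [bern, if_true] at h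
  rw [eq_sub_of_add_eq h.symm, alphaOne, thetaBar]
  ring

lemma prob_flipped_false_add_true (hA : 0 < A) (hβ : 0 < β) (hγ : 0 < γ) (p : Fin N → ℝ)
    (T : Fin N → Finset (Fin q → Bool)) (i : Fin N) (a : Bool) :
    prob A β γ p (fun x k => x i = a ∧ flippedOutput T i x k = false) +
      prob A β γ p (fun x k => x i = a ∧ flippedOutput T i x k = true) = bern (p i) a := by
  rw [← prob_input hA hβ hγ p i a]
  refine (prob_add_of_iff p (fun x k => ?_) fun x k h1 h2 => ?_).symm
  · cases flippedOutput T i x k <;> simp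
  · rw [h1.2] at h2
    cases h2.2

/-- Joint probability function of the input and the flipped output of bit-pipe `i`. -/
noncomputable def jointProb (A β γ : ℝ) (T : Fin N → Finset (Fin q → Bool)) (p : Fin N → ℝ) (i : Fin N)
    (a b : Bool) : ℝ :=
  prob A β γ p (fun x k => x i = a ∧ flippedOutput T i x k = b)

lemma condProb_flipped_zero (hA : 0 < A) (hβ : 0 < β) (hγ : 0 < γ) {p : Fin N → ℝ}
    (hp : ∀ i, 0 ≤ p i ∧ p i ≤ 1) (T : Fin N → Finset (Fin q → Bool)) (i : Fin N)
    (hi : p i ≠ 1) : condProb A β γ p (fun x k => flippedOutput T i x k = true)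
      (fun x _ => x i = false) = alphaZero A β γ T p i := by
  rw [condProb, prob_input hA hβ hγ, prob_congr p fun x k => and_comm,
    prob_zero_true hA hβ hγ hp]
  simp only [bern, Bool.false_eq_true, if_false]
  rw [mul_div_cancel_left₀ _ (sub_ne_zero.2 hi.symm)]

lemma condProb_flipped_one (hA : 0 < A) (hβ : 0 < β) (hγ : 0 < γ) {p : Fin N → ℝ}
    (hp : ∀ i, 0 ≤ p i ∧ p i ≤ 1) (T : Fin N → Finset (Fin q → Bool)) (i : Fin N)
    (hi : p i ≠ 0) : condProb A β γ p (fun x k => flippedOutput T i x k = false)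
      (fun x _ => x i = true) = alphaOne A β γ T p i := by
  rw [condProb, prob_input hA hβ hγ, prob_congr p fun x k => and_comm,
    prob_one_false hA hβ hγ hp]
  simp only [bern, if_true]
  rw [mul_div_cancel_left₀ _ hi]

end Prob

/-! ### Mutual information -/

lemma mul_log_div_mul {j r c : ℝ} (hr : j ≠ 0 → r ≠ 0) (hc : j ≠ 0 → c ≠ 0) :
    j * Real.log (j / (r * c)) = j * Real.log j - j * Real.log r - j * Real.log c := by
  by_cases h : j = 0
  · simp [h]
  · rw [Real.log_div h (mul_ne_zero (hr h) (hc h)), Real.log_mul (hr h) (hc h)]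
    ring

/-- Mutual information as a combination of entropies. -/
lemma mutualInfo_mul_log_two {J : Bool → Bool → ℝ} (hJ : ∀ a b, 0 ≤ J a b) :
    mutualInfo J * Real.log 2 = ∑ a, Real.negMulLog (∑ b, J a b) +
      ∑ b, Real.negMulLog (∑ a, J a b) - ∑ a, ∑ b, Real.negMulLog (J a b) := by
  have hlog : Real.log 2 ≠ 0 := (Real.log_pos one_lt_two).ne'
  have h : ∀ a b, J a b * Real.logb 2 (J a b / ((∑ b', J a b') * ∑ a', J a' b)) * Real.log 2 =
      J a b * Real.log (J a b) - J a b * Real.log (∑ b', J a b') -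
        J a b * Real.log (∑ a', J a' b) := by
    intro a b
    rw [← mul_log_div_mul, Real.logb, mul_assoc, div_mul_cancel₀ _ hlog]
    · intro h
      refine (lt_of_lt_of_le (lt_of_le_of_ne (hJ a b) h.symm) ?_).ne'
      exact Finset.single_le_sum (fun b _ => hJ a b) (Finset.mem_univ b)
    · intro h
      refine (lt_of_lt_of_le (lt_of_le_of_ne (hJ a b) h.symm) ?_).ne'
      exact Finset.single_le_sum (f := fun a => J a b) (fun a _ => hJ a b) (Finset.mem_univ a)
  rw [mutualInfo, Finset.sum_mul]
  refine (Finset.sum_congr rfl fun a _ => (Finset.sum_mul _ _ _).trans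
    (Finset.sum_congr rfl fun b _ => h a b)).trans ?_
  simp only [Real.negMulLog, Fintype.sum_bool]
  ring

/-- Chain rule for entropy: a mass `r` is split in the proportion `a : 1 - a`. -/
lemma negMulLog_mul_add (r a : ℝ) :
    Real.negMulLog (r * a) + Real.negMulLog (r * (1 - a)) =
      Real.negMulLog r + r * Real.binEntropy a := by
  rw [Real.negMulLog_mul, Real.negMulLog_mul,
    Real.binEntropy_eq_negMulLog_add_negMulLog_one_sub]
  ring

/-! ### The rate terms as mutual informations, and their continuity -/

section Phi

variable {A β γ : ℝ} {N q : ℕ}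

lemma jointProb_nonneg (hA : 0 < A) (hβ : 0 < β) (hγ : 0 < γ) {p : Fin N → ℝ}
    (hp : ∀ i, 0 ≤ p i ∧ p i ≤ 1) (T : Fin N → Finset (Fin q → Bool)) (i : Fin N) (a b : Bool) :
    0 ≤ jointProb A β γ T p i a b :=
  prob_nonneg hA hβ hγ hp _

lemma sum_jointProb (hA : 0 < A) (hβ : 0 < β) (hγ : 0 < γ) (p : Fin N → ℝ)
    (T : Fin N → Finset (Fin q → Bool)) (i : Fin N) (a : Bool) :
    ∑ b, jointProb A β γ T p i a b = bern (p i) a := by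
  rw [← prob_flipped_false_add_true hA hβ hγ p T i a, Fintype.sum_bool, add_comm]
  rfl

/-- The chain rule applied to each input value cancels the input entropy and leaves the output
entropy minus the conditional entropy. -/
lemma Phi_eq_mutualInfo (hA : 0 < A) (hβ : 0 < β) (hγ : 0 < γ) {p : Fin N → ℝ}
    (hp : ∀ i, 0 ≤ p i ∧ p i ≤ 1) (T : Fin N → Finset (Fin q → Bool)) (i : Fin N) :
    Phi A β γ T p i = mutualInfo (jointProb A β γ T p i) := by
  have hlog : Real.log 2 ≠ 0 := (Real.log_pos one_lt_two).ne'
  refine mul_right_cancel₀ hlog ?_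
  rw [mutualInfo_mul_log_two (jointProb_nonneg hA hβ hγ hp T i)]
  simp only [sum_jointProb hA hβ hγ]
  have h01 : jointProb A β γ T p i false true = (1 - p i) * alphaZero A β γ T p i :=
    prob_zero_true hA hβ hγ hp T i
  have h10 : jointProb A β γ T p i true false = p i * alphaOne A β γ T p i :=
    prob_one_false hA hβ hγ hp T i
  have h0 := sum_jointProb hA hβ hγ p T i false
  have h1 := sum_jointProb hA hβ hγ p T i true
  rw [Fintype.sum_bool, h01] at h0
  rw [Fintype.sum_bool, h10] at h1
  simp only [bern, Bool.false_eq_true, if_false, if_true] at h0 h1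
  have h00 : jointProb A β γ T p i false false = (1 - p i) * (1 - alphaZero A β γ T p i) := by
    linarith
  have h11 : jointProb A β γ T p i true true = p i * (1 - alphaOne A β γ T p i) := by
    linarith
  simp only [Fintype.sum_bool, h01, h10, h00, h11, bern, Bool.false_eq_true, if_false, if_true]
  have e0 := negMulLog_mul_add (1 - p i) (alphaZero A β γ T p i)
  have e1 := negMulLog_mul_add (p i) (alphaOne A β γ T p i)
  have e2 := Real.binEntropy_eq_negMulLog_add_negMulLog_one_sub
    ((1 - p i) * alphaZero A β γ T p i + p i * (1 - alphaOne A β γ T p i))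
  rw [show 1 - ((1 - p i) * alphaZero A β γ T p i + p i * (1 - alphaOne A β γ T p i)) =
    p i * alphaOne A β γ T p i + (1 - p i) * (1 - alphaZero A β γ T p i) by ring,
    add_comm ((1 - p i) * _)] at e2
  have e3 : ∀ y a b : ℝ, (Real.binEntropy y / Real.log 2 -
      (1 - p i) * (Real.binEntropy a / Real.log 2) - p i * (Real.binEntropy b / Real.log 2)) *
      Real.log 2 = Real.binEntropy y - (1 - p i) * Real.binEntropy a -
      p i * Real.binEntropy b := by
    intro y a b
    field_simp
  rw [Phi, hBin, hBin, hBin, e3, add_comm ((1 - p i) * _), e2]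
  linarith

lemma continuous_jointProb (T : Fin N → Finset (Fin q → Bool)) (i : Fin N) (a b : Bool) :
    Continuous fun p : Fin N → ℝ => jointProb A β γ T p i a b := by
  unfold jointProb prob inputProb
  refine continuous_finsetSum _ fun x _ => continuous_finsetSum _ fun k _ => ?_
  split_ifs
  · refine Continuous.mul (continuous_finsetProd _ fun j _ => ?_) continuous_const
    split_ifs <;> fun_prop
  · exact continuous_const

/-- `theta` and `thetaBar` may jump where the conditioning event becomes null, so continuity is read
off the entropy form, whose arguments are polynomial in `p`. -/
lemma continuousOn_Phi (hA : 0 < A) (hβ : 0 < β) (hγ : 0 < γ)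
    (T : Fin N → Finset (Fin q → Bool)) (i : Fin N) :
    ContinuousOn (fun p : Fin N → ℝ => Phi A β γ T p i) {p | ∀ i, 0 ≤ p i ∧ p i ≤ 1} := by
  have hlog : Real.log 2 ≠ 0 := (Real.log_pos one_lt_two).ne'
  have hc := fun a b => continuous_jointProb (A := A) (β := β) (γ := γ) T i a b
  have h : Continuous fun p : Fin N → ℝ =>
      (∑ a, Real.negMulLog (∑ b, jointProb A β γ T p i a b) +
      ∑ b, Real.negMulLog (∑ a, jointProb A β γ T p i a b) -
      ∑ a, ∑ b, Real.negMulLog (jointProb A β γ T p i a b)) / Real.log 2 := by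
    have hn := Real.continuous_negMulLog
    fun_prop
  refine h.continuousOn.congr fun p hp => ?_
  simp only
  rw [Phi_eq_mutualInfo hA hβ hγ hp, ← mutualInfo_mul_log_two (jointProb_nonneg hA hβ hγ hp T i),
    mul_div_cancel_right₀ _ hlog]

end Phi
/-! ### Existence of optimal input parameters -/

/-- The support of `p` does not vary continuously. Replaced by a fixed set `S` containing it, it
leaves only closed conditions, and there are finitely many `S`; compactness follows. -/
lemma feasible_iff {A E γ : ℝ} {N : ℕ} (p : Fin N → ℝ) : Feasible A E γ p ↔
    ∃ S : Finset (Fin N), ∑ i ∈ S, (2 : ℝ) ^ (i : ℕ) ≤ γ * A ∧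
      (∀ i, 0 ≤ p i ∧ p i ≤ 1) ∧ (∀ i ∉ S, p i = 0) ∧ ∑ i, p i * (2 : ℝ) ^ (i : ℕ) ≤ γ * E := by
  have hsum : ∀ p : Fin N → ℝ, (∀ i, 0 ≤ p i ∧ p i ≤ 1) →
      ∑ i ∈ Finset.univ.filter (fun i => 0 < p i), p i * (2 : ℝ) ^ (i : ℕ) =
        ∑ i, p i * (2 : ℝ) ^ (i : ℕ) := by
    intro p hp
    refine Finset.sum_filter_of_ne fun i _ hi => lt_of_le_of_ne (hp i).1 fun h => hi ?_
    rw [← h, zero_mul]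
  constructor
  · rintro ⟨h1, h2, h3⟩
    refine ⟨Finset.univ.filter (fun i => 0 < p i), h2, h1, fun i hi => ?_, hsum p h1 ▸ h3⟩
    simp only [Finset.mem_filter, Finset.mem_univ, true_and, not_lt] at hi
    exact le_antisymm hi (h1 i).1
  · rintro ⟨S, h1, h2, h3, h4⟩
    refine ⟨h2, le_trans (Finset.sum_le_sum_of_subset_of_nonneg (fun i hi => ?_)
      fun i _ _ => by positivity) h1, (hsum p h2).symm ▸ h4⟩
    by_contra hS
    exact (Finset.mem_filter.1 hi).2.ne' (h3 i hS)

lemma isCompact_feasible (A E γ : ℝ) (N : ℕ) : IsCompact {p : Fin N → ℝ | Feasible A E γ p} := by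
  have hbox : IsCompact (Set.univ.pi fun _ : Fin N => Set.Icc (0 : ℝ) 1) :=
    isCompact_univ_pi fun _ => isCompact_Icc
  refine hbox.of_isClosed_subset ?_ fun p hp i _ => hp.1 i
  have h : {p : Fin N → ℝ | Feasible A E γ p} =
      ⋃ S ∈ {S : Finset (Fin N) | ∑ i ∈ S, (2 : ℝ) ^ (i : ℕ) ≤ γ * A},
        ({p : Fin N → ℝ | ∀ i, 0 ≤ p i ∧ p i ≤ 1} ∩ ({p | ∀ i, i ∉ S → p i = 0} ∩
          {p | ∑ i, p i * (2 : ℝ) ^ (i : ℕ) ≤ γ * E})) := by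
    ext p
    simp only [Set.mem_ofPred_eq, feasible_iff, Set.mem_iUnion, Set.mem_inter_iff, exists_prop]
  rw [h]
  refine (Set.toFinite _).isClosed_biUnion fun S _ => IsClosed.inter ?_ (IsClosed.inter ?_ ?_)
  · simp only [Set.ofPred_forall, Set.ofPred_and]
    exact isClosed_iInter fun i => IsClosed.inter
      (isClosed_le continuous_const (continuous_apply i))
      (isClosed_le (continuous_apply i) continuous_const)
  · simp only [Set.ofPred_forall]
    exact isClosed_iInter fun i => isClosed_iInter fun _ =>
      isClosed_eq (continuous_apply i) continuous_const
  · exact isClosed_le (by fun_prop) continuous_const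

lemma feasible_zero {A E γ : ℝ} (hA : 0 < A) (hE : 0 < E) (hγ : 0 < γ) (N : ℕ) :
    Feasible A E γ (fun _ : Fin N => 0) := by
  refine ⟨fun i => by simp, ?_, ?_⟩ <;> simp <;> positivity

lemma Phi_of_eq_zero {A β γ : ℝ} {N q : ℕ} (T : Fin N → Finset (Fin q → Bool)) {p : Fin N → ℝ}
    {i : Fin N} (hi : p i = 0) : Phi A β γ T p i = 0 := by
  simp [Phi, hi]

/-! ### The successive receiver with correct decisions -/

section Receiver

variable {N n q : ℕ}

/-- Carry bits deduced from the input and the output of the vector binary channel. -/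
def carryOf (x v : Fin N → Bool) : ℕ → Bool
  | 0 => false
  | i + 1 => carryOut (bitAt x i) (xor (xor (bitAt v i) (bitAt x i)) (carryOf x v i)) (carryOf x v i)

lemma carryOf_output (x : Fin N → Bool) (k : ℤ) {i : ℕ} (hi : i ≤ N) :
    carryOf x (output x k) i = carry x k i := by
  induction i with
  | zero => rfl
  | succ i ih =>
    have hiN : i < N := hi
    rw [carryOf, carry, ih hiN.le]
    congr 1
    simp only [bitAt, hiN, dif_pos, output]
    cases x ⟨i, hiN⟩ <;> cases noiseBit N k i <;> cases carry x k i <;> rfl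

/-- The symbol that a receiver with correct carry bits hands to the decoder of bit-pipe `i`. -/
def observe (T : Fin N → Finset (Fin q → Bool)) (i : Fin N) (x : Fin N → Bool)
    (y : Option (Fin N → Bool)) : Option Bool :=
  y.map fun v => flipped (T i) v (carryOf x v i) i

/-- Induction on the bit-pipe: correct carries at all unerased times give the decoder the genie's
sequence, hence the right message, hence the right next carry. Erased times are left out; the
estimate there is a default that no decoder sees. -/
lemma carryEst_eq (C : Code N n) (T : Fin N → Finset (Fin q → Bool))
    (y : Fin n → Option (Fin N → Bool)) (m : (i : Fin N) → Fin (C.size i))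
    (hm : ∀ i, C.dec i (fun t => observe T i (C.input m t) (y t)) = m i) {i : ℕ} (hi : i ≤ N)
    (t : Fin n) (v : Fin N → Bool) (hv : y t = some v) :
    C.carryEst T y i t = carryOf (C.input m t) v i := by
  induction i generalizing t v with
  | zero => rfl
  | succ i ih =>
    have hiN : i < N := hi
    have hdec : Code.decoderInput T y (C.carryEst T y i) ⟨i, hiN⟩ =
        fun t => observe T ⟨i, hiN⟩ (C.input m t) (y t) := by
      funext t
      rw [Code.decoderInput, observe]
      cases h : y t with
      | none => rfl
      | some v => rw [Option.map_some, Option.map_some, ih hiN.le t v h]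
    simp only [Code.carryEst, hiN, dif_pos, hv, hdec, hm, ih hiN.le t v hv, carryOf, bitAt]
    rfl

lemma decide_eq (C : Code N n) (T : Fin N → Finset (Fin q → Bool))
    (y : Fin n → Option (Fin N → Bool)) (m : (i : Fin N) → Fin (C.size i))
    (hm : ∀ i, C.dec i (fun t => observe T i (C.input m t) (y t)) = m i) :
    C.decide T y = m := by
  funext i
  rw [← hm i, Code.decide]
  congr 1
  funext t
  rw [Code.decoderInput, observe]
  cases h : y t with
  | none => rfl
  | some v => rw [Option.map_some, Option.map_some, carryEst_eq C T y m hm i.2.le t v h]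

end Receiver

/-! ### Laws of the bit-pipes -/

section Laws

variable {A β γ ε : ℝ} {N q : ℕ}

lemma transProb_nonneg (hA : 0 < A) (hβ : 0 < β) (hγ : 0 < γ) (h0 : 0 ≤ ε) (h1 : ε ≤ 1)
    (x : Fin N → Bool) (y : Option (Fin N → Bool)) : 0 ≤ transProb A β γ ε x y := by
  cases y with
  | none => exact h0
  | some v =>
    refine mul_nonneg (sub_nonneg.2 h1) (Finset.sum_nonneg fun k _ => ?_)
    split_ifs
    exacts [noiseProb_nonneg hA hβ hγ k, le_rfl]

lemma sum_transProb (hA : 0 < A) (hβ : 0 < β) (hγ : 0 < γ) (x : Fin N → Bool) :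
    ∑ y, transProb A β γ ε x y = 1 := by
  rw [Fintype.sum_option]
  simp only [transProb]
  rw [← Finset.mul_sum, Finset.sum_comm]
  simp [sum_noiseProb hA hβ hγ]

lemma pipeLaw_none (p : Fin N → ℝ) (T : Fin N → Finset (Fin q → Bool)) (i : Fin N) (a : Bool) :
    pipeLaw p (transProb A β γ ε) (observe T i) i (a, none) = bern (p i) a * ε := by
  classical
  rw [pipeLaw, Finset.sum_filter, Fintype.sum_prod_type, ← sum_inputProb_filter,
    Finset.sum_filter, Finset.sum_mul]
  refine Finset.sum_congr rfl fun x _ => ?_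
  rw [Fintype.sum_option, Finset.sum_eq_zero]
  · by_cases hx : x i = a <;> simp [hx, observe, useLaw, transProb]
  · intro v _
    simp [observe]

lemma pipeLaw_some (p : Fin N → ℝ) (T : Fin N → Finset (Fin q → Bool)) (i : Fin N) (a b : Bool) :
    pipeLaw p (transProb A β γ ε) (observe T i) i (a, some b) =
      (1 - ε) * jointProb A β γ T p i a b := by
  classical
  rw [pipeLaw, Finset.sum_filter, Fintype.sum_prod_type, jointProb, prob, Finset.mul_sum]
  refine Finset.sum_congr rfl fun x _ => ?_
  rw [Fintype.sum_option]
  simp only [observe, Option.map_none, Option.map_some, useLaw, transProb, Prod.mk.injEq,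
    reduceCtorEq, and_false, if_false, zero_add, Option.some.injEq]
  by_cases hx : x i = a
  · simp only [hx, true_and, Finset.mul_sum]
    have h : ∀ v : Fin N → Bool, (if flipped (T i) v (carryOf x v i) i = b then
        ∑ k ∈ noiseRange A β γ, inputProb p x * ((1 - ε) *
          if output x k = v then noiseProb A β γ k else 0) else 0) =
        ∑ k ∈ noiseRange A β γ, if output x k = v then
          (if flipped (T i) v (carryOf x v i) i = b then
            (1 - ε) * (inputProb p x * noiseProb A β γ k) else 0) else 0 := by
      intro v
      split_ifs with hv
      · refine Finset.sum_congr rfl fun k _ => ?_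
        split_ifs <;> ring
      · simp
    simp only [h]
    rw [Finset.sum_comm]
    refine Finset.sum_congr rfl fun k _ => ?_
    -- On actual channel outputs `carryOf` is the true carry, so the genie's symbol is
    -- `flippedOutput`.
    rw [Finset.sum_ite_eq, if_pos (Finset.mem_univ _), carryOf_output x k i.2.le, flippedOutput]
    split_ifs <;> simp
  · simp [hx]

lemma obsLaw_eq_sum {Y V : Type*} [Fintype Y] (p : Fin N → ℝ) (W : (Fin N → Bool) → Y → ℝ)
    (g : (Fin N → Bool) → Y → V) (i : Fin N) (v : V) :
    obsLaw p W g v = ∑ a, pipeLaw p W g i (a, v) := by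
  classical
  simp only [obsLaw, pipeLaw, Finset.sum_filter, Prod.mk.injEq]
  rw [Finset.sum_comm]
  refine Finset.sum_congr rfl fun s _ => ?_
  by_cases h : g s.1 s.2 = v <;> cases s.1 i <;> simp [h]

/-- Erasures scale the mutual information of a bit-pipe by `1 - ε`. -/
lemma sum_pipeLaw_mul_log (hA : 0 < A) (hβ : 0 < β) (hγ : 0 < γ) {p : Fin N → ℝ}
    (hp : ∀ i, 0 ≤ p i ∧ p i ≤ 1) (T : Fin N → Finset (Fin q → Bool)) (i : Fin N) :
    ∑ r, pipeLaw p (transProb A β γ ε) (observe T i) i r *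
      Real.log (pipeLaw p (transProb A β γ ε) (observe T i) i r /
        (bern (p i) r.1 * obsLaw p (transProb A β γ ε) (observe T i) r.2)) =
      (1 - ε) * Phi A β γ T p i * Real.log 2 := by
  have hlog : Real.log 2 ≠ 0 := (Real.log_pos one_lt_two).ne'
  rw [Phi_eq_mutualInfo hA hβ hγ hp, mutualInfo, Fintype.sum_prod_type, Finset.mul_sum,
    Finset.sum_mul]
  refine Finset.sum_congr rfl fun a _ => ?_
  rw [Fintype.sum_option, Finset.mul_sum, Finset.sum_mul]
  have hnone : obsLaw p (transProb A β γ ε) (observe T i) none = ε := by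
    simp only [obsLaw_eq_sum p _ _ i, pipeLaw_none, ← Finset.sum_mul, sum_bern, one_mul]
  have hsome : ∀ b, obsLaw p (transProb A β γ ε) (observe T i) (some b) =
      (1 - ε) * ∑ a, jointProb A β γ T p i a b := fun b => by
    simp only [obsLaw_eq_sum p _ _ i, pipeLaw_some, ← Finset.mul_sum]
  simp only [hnone, hsome, pipeLaw_none, pipeLaw_some, sum_jointProb hA hβ hγ]
  -- An erasure is independent of the input and carries no information; if the mass is zero, the
  -- default `log (0 / 0) = 0` agrees.
  have h1 : Real.log (bern (p i) a * ε / (bern (p i) a * ε)) = 0 := by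
    by_cases h : bern (p i) a * ε = 0
    · simp [h]
    · rw [div_self h, Real.log_one]
  rw [h1, mul_zero, zero_add]
  refine Finset.sum_congr rfl fun b _ => ?_
  by_cases hε : 1 - ε = 0
  · simp [hε]
  · rw [mul_left_comm (bern (p i) a), mul_div_mul_left _ _ hε, Real.logb]
    field_simp

end Laws

/-! ### Achievability -/

section Achievability

variable {A E β γ ε : ℝ} {N q : ℕ}

/-- The peak bound holds even when all active pipes send 1, because the others are silent. The
average bound adds up the codeword weights. -/
lemma meetsConstraints_of_weight {n : ℕ} (hγ : 0 < γ) {p : Fin N → ℝ} (hp : Feasible A E γ p)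
    (C : Code N n)
    (hC : ∀ i m, ∑ t, (if C.enc i m t then (1 : ℝ) else 0) ≤ n * p i) :
    C.RespectsOff p → C.MeetsConstraints A E γ := by
  intro hoff m
  constructor
  · intro t
    rw [Code.intensity, div_le_iff₀ hγ, mul_comm A]
    refine le_trans ?_ hp.2.1
    rw [Finset.sum_filter]
    refine Finset.sum_le_sum fun i _ => ?_
    by_cases hi : 0 < p i
    · rw [if_pos hi]
      split_ifs
      exacts [le_rfl, by positivity]
    · have h0 : p i = 0 := le_antisymm (not_lt.1 hi) (hp.1 i).1
      simp [Code.input, (hoff i h0).2, h0]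
  · obtain ⟨S, -, -, -, hE⟩ := (feasible_iff p).1 hp
    simp only [Code.intensity]
    rw [← Finset.sum_div, div_le_iff₀ hγ, Finset.sum_comm]
    calc ∑ i : Fin N, ∑ t, (if C.input m t i then (2 : ℝ) ^ (i : ℕ) else 0)
        = ∑ i : Fin N, (∑ t, (if C.enc i (m i) t then (1 : ℝ) else 0)) * (2 : ℝ) ^ (i : ℕ) := by
          refine Finset.sum_congr rfl fun i _ => ?_
          rw [Finset.sum_mul]
          refine Finset.sum_congr rfl fun t _ => ?_
          rw [ite_mul, one_mul, zero_mul]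
          rfl
      _ ≤ ∑ i : Fin N, n * p i * (2 : ℝ) ^ (i : ℕ) :=
          Finset.sum_le_sum fun i _ => mul_le_mul_of_nonneg_right (hC i (m i)) (by positivity)
      _ = n * ∑ i : Fin N, p i * (2 : ℝ) ^ (i : ℕ) := by
          rw [Finset.mul_sum]
          exact Finset.sum_congr rfl fun i _ => by ring
      _ ≤ n * (γ * E) := mul_le_mul_of_nonneg_left hE (Nat.cast_nonneg n)
      _ = n * E * γ := by ring

/-- Separate codes on the bit-pipes attain every rate below `(1 - ε) ∑ i, Φ i (p')`, for Bernoulli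
parameters `p'` slightly smaller than the admissible parameters `p`. -/
lemma achieves_of_lt (hA : 0 < A) (hβ : 0 < β) (hγ : 0 < γ) (h0 : 0 ≤ ε) (h1 : ε ≤ 1)
    (T : Fin N → Finset (Fin q → Bool)) {p p' : Fin N → ℝ} (hp : Feasible A E γ p)
    (hp' : ∀ i, 0 ≤ p' i ∧ p' i ≤ 1) (hpp : ∀ i, p' i < p i ∨ p' i = 0 ∧ p i = 0) :
    Achieves A E β γ ε T p ((1 - ε) * ∑ i, Phi A β γ T p' i) := by
  intro R' hR' δ hδ
  have hlog : 0 < Real.log 2 := Real.log_pos one_lt_two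
  -- The rate gap is shared among the pipes; dividing by `N + 1` avoids a separate case `N = 0`.
  obtain ⟨η, hη, hηR⟩ : ∃ η : ℝ, 0 < η ∧ R' ≤ ∑ i, ((1 - ε) * Phi A β γ T p' i - η) := by
    refine ⟨((1 - ε) * ∑ i, Phi A β γ T p' i - R') / (N + 1), ?_, ?_⟩
    · exact div_pos (by linarith) (by positivity)
    · rw [Finset.sum_sub_distrib, ← Finset.mul_sum, Finset.sum_const, Finset.card_univ,
        Fintype.card_fin, nsmul_eq_mul]
      have hN : (N : ℝ) * (((1 - ε) * ∑ i, Phi A β γ T p' i - R') / (N + 1)) ≤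
          (1 - ε) * ∑ i, Phi A β γ T p' i - R' := by
        rw [← mul_div_assoc, div_le_iff₀ (by positivity)]
        nlinarith
      linarith
  set R : Fin N → ℝ := fun i => ((1 - ε) * Phi A β γ T p' i - η) * Real.log 2 with hR
  obtain ⟨n₀, hn₀⟩ := exists_codebook (R := R) (p := p) hp'
    (fun i => (hpp i).imp id fun h => ⟨h.1, h.2.ge⟩)
    (W := transProb A β γ ε) (transProb_nonneg hA hβ hγ h0 h1) (sum_transProb hA hβ hγ)
    (observe T) (fun i => by
      rw [sum_pipeLaw_mul_log hA hβ hγ hp']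
      simp only [hR]
      exact mul_lt_mul_of_pos_right (by linarith) hlog) hδ
  refine ⟨n₀ + 1, fun n hn => ?_⟩
  have hn0 : (0 : ℝ) < n := by exact_mod_cast (show 0 < n by omega)
  -- Rounding up meets the target rate and leaves at most `exp (n R i)` competitors. A silent pipe
  -- has `Φ = 0`, so `R i < 0` and its message set is a single point.
  have hMpos : ∀ i, 0 < ⌈Real.exp (n * R i)⌉₊ := fun i => Nat.ceil_pos.2 (Real.exp_pos _)
  obtain ⟨enc, dec, hwt, herr⟩ := hn₀ n (by omega) (fun i => ⌈Real.exp (n * R i)⌉₊) hMpos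
    (fun i => by linarith [Nat.ceil_lt_add_one (Real.exp_pos (n * R i)).le])
  set C : Code N n := ⟨fun i => ⌈Real.exp (n * R i)⌉₊, hMpos, enc, dec⟩ with hC
  have hoff : C.RespectsOff p := by
    intro i hi
    have hp0 : p' i = 0 := by
      rcases hpp i with h | h
      · exact absurd h (by rw [hi]; exact not_lt.2 (hp' i).1)
      · exact h.1
    constructor
    · refine le_antisymm (Nat.ceil_le.2 ?_) (hMpos i)
      rw [Nat.cast_one, Real.exp_le_one_iff]
      simp only [hR, Phi_of_eq_zero T hp0]
      exact mul_nonpos_of_nonneg_of_nonpos hn0.le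
        (mul_nonpos_of_nonpos_of_nonneg (by linarith) hlog.le)
    · intro m t
      have h := hwt i m
      rw [hi, mul_zero] at h
      by_contra hcon
      have hx : enc i m t = true := Bool.eq_true_of_not_eq_false hcon
      have h2 := Finset.single_le_sum (f := fun t => if enc i m t then (1 : ℝ) else 0)
        (fun t _ => by split_ifs <;> simp) (Finset.mem_univ t)
      simp only [hx, if_true] at h2
      linarith
  refine ⟨C, hoff, meetsConstraints_of_weight hγ hp C hwt hoff, ?_, ?_⟩
  · refine hηR.trans ?_
    rw [Code.rate, le_div_iff₀ hn0, Finset.sum_mul]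
    refine Finset.sum_le_sum fun i _ => ?_
    rw [Real.logb, le_div_iff₀ hlog, Real.le_log_iff_exp_le (Nat.cast_pos.2 (hMpos i))]
    refine le_trans (le_of_eq ?_) (Nat.le_ceil (Real.exp (n * R i)))
    congr 1
    simp only [hR]
    ring
  · have hMp : 0 < ∏ i, (C.size i : ℝ) :=
      Finset.prod_pos fun i _ => Nat.cast_pos.2 (hMpos i)
    rw [Code.errorProb, div_le_iff₀ hMp, mul_comm]
    refine le_trans (Finset.sum_le_sum fun m _ => Finset.sum_le_sum fun y _ => ?_) herr
    have hnn : 0 ≤ ∏ t, transProb A β γ ε (C.input m t) (y t) :=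
      Finset.prod_nonneg fun t _ => transProb_nonneg hA hβ hγ h0 h1 _ _
    by_cases h : ∀ i, dec i (fun t => observe T i (fun j => enc j (m j) t) (y t)) = m i
    · rw [if_pos (decide_eq C T y m h), if_pos h, mul_zero]
    · rw [if_neg h, mul_one]
      split_ifs
      exacts [hnn, le_rfl]

end Achievability

end CDBAC

/-! ### The maximizer and the achieved rate -/

theorem theorem6 (A E β γ : ℝ) (hA : 0 < A) (hE : 0 < E) (hEA : E ≤ A) (hβ : 0 < β) (hγ : 0 < γ)
    (N : ℕ) (hN : N = ⌈Real.logb 2 (γ * (A + 2 * β))⌉₊)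
    (q : ℕ) (hq : 1 ≤ q) (hqN : q ≤ N - 1) (T : Fin N → Finset (Fin q → Bool)) :
    (∀ p : Fin N → ℝ, (∀ i, 0 ≤ p i ∧ p i ≤ 1) → ∀ i : Fin N,
      (p i ≠ 1 → CDBAC.condProb A β γ p (fun x k => CDBAC.flippedOutput T i x k = true)
        (fun x _ => x i = false) = CDBAC.alphaZero A β γ T p i) ∧
      (p i ≠ 0 → CDBAC.condProb A β γ p (fun x k => CDBAC.flippedOutput T i x k = false)
        (fun x _ => x i = true) = CDBAC.alphaOne A β γ T p i) ∧
      CDBAC.Phi A β γ T p i = CDBAC.mutualInfo (fun a b =>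
        CDBAC.prob A β γ p (fun x k => x i = a ∧ CDBAC.flippedOutput T i x k = b))) ∧
    ∃ p : Fin N → ℝ, CDBAC.Feasible A E γ p ∧
      (∀ p' : Fin N → ℝ, CDBAC.Feasible A E γ p' →
        ∑ i, CDBAC.Phi A β γ T p' i ≤ ∑ i, CDBAC.Phi A β γ T p i) ∧
      ∀ ε : ℝ, 0 ≤ ε → ε ≤ CDBAC.epsBar β →
        CDBAC.Achieves A E β γ ε T p
          ((1 - CDBAC.epsBar β) * ∑ i, CDBAC.Phi A β γ T p i) := by
  refine ⟨fun p hp i => ⟨CDBAC.condProb_flipped_zero hA hβ hγ hp T i,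
    CDBAC.condProb_flipped_one hA hβ hγ hp T i, CDBAC.Phi_eq_mutualInfo hA hβ hγ hp T i⟩, ?_⟩
  have hcont : ContinuousOn (fun p : Fin N → ℝ => ∑ i, CDBAC.Phi A β γ T p i)
      {p | ∀ i, 0 ≤ p i ∧ p i ≤ 1} :=
    continuousOn_finsetSum _ fun i _ => CDBAC.continuousOn_Phi hA hβ hγ T i
  obtain ⟨p, hp, hmax⟩ := (CDBAC.isCompact_feasible A E γ N).exists_isMaxOn
    ⟨_, CDBAC.feasible_zero hA hE hγ N⟩ (hcont.mono fun p hp => hp.1)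
  refine ⟨p, hp, fun p' hp' => hmax hp', fun ε h0 hε R' hR' => ?_⟩
  have h1 : ε < 1 := hε.trans_lt (CDBAC.epsBar_lt_one hβ)
  -- Comparison with the feasible point 0. The sign is what allows `1 - epsBar β` to be replaced by
  -- the larger `1 - ε`.
  have hnn : 0 ≤ ∑ i, CDBAC.Phi A β γ T p i := by
    have h : ∑ i, CDBAC.Phi A β γ T (fun _ => 0) i ≤ ∑ i, CDBAC.Phi A β γ T p i :=
      hmax (CDBAC.feasible_zero hA hE hγ N)
    rwa [Finset.sum_eq_zero fun i _ => CDBAC.Phi_of_eq_zero T rfl] at h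
  have hR : R' < (1 - ε) * ∑ i, CDBAC.Phi A β γ T p i :=
    hR'.trans_le (mul_le_mul_of_nonneg_right (by linarith) hnn)
  -- Scaling by `τ < 1` makes every active parameter strictly smaller, as the conditioned codeword
  -- law needs, and keeps zeros at zero; the loss in rate vanishes as `τ → 1`.
  have hlim : Filter.Tendsto (fun τ : ℝ => (1 - ε) * ∑ i, CDBAC.Phi A β γ T (τ • p) i)
      (nhdsWithin 1 (Set.Ioo 0 1)) (nhds ((1 - ε) * ∑ i, CDBAC.Phi A β γ T p i)) := by
    refine Filter.Tendsto.const_mul _ ?_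
    have hτ : Filter.Tendsto (fun τ : ℝ => τ • p) (nhdsWithin 1 (Set.Ioo 0 1))
        (nhdsWithin p {p | ∀ i, 0 ≤ p i ∧ p i ≤ 1}) := by
      refine tendsto_nhdsWithin_iff.2 ⟨?_, ?_⟩
      · have h : Continuous fun τ : ℝ => τ • p := by fun_prop
        have h2 := h.tendsto 1
        rw [one_smul] at h2
        exact h2.mono_left nhdsWithin_le_nhds
      · filter_upwards [self_mem_nhdsWithin] with τ hτ i
        exact ⟨mul_nonneg hτ.1.le (hp.1 i).1, mul_le_one₀ hτ.2.le (hp.1 i).1 (hp.1 i).2⟩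
    exact (hcont p hp.1).tendsto.comp hτ
  have hne : (nhdsWithin (1 : ℝ) (Set.Ioo 0 1)).NeBot := by
    rw [← mem_closure_iff_nhdsWithin_neBot, closure_Ioo zero_ne_one]
    exact ⟨zero_le_one, le_rfl⟩
  obtain ⟨τ, hτR, hτ0, hτ1⟩ :=
    ((hlim.eventually (lt_mem_nhds hR)).and self_mem_nhdsWithin).exists
  refine CDBAC.achieves_of_lt hA hβ hγ h0 h1.le T hp (p' := τ • p)
    (fun i => ⟨mul_nonneg hτ0.le (hp.1 i).1, mul_le_one₀ hτ1.le (hp.1 i).1 (hp.1 i).2⟩)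
    (fun i => ?_) R' hτR
  rcases (hp.1 i).1.eq_or_lt with h | h
  · right
    simp [← h]
  · left
    exact mul_lt_of_lt_one_left h hτ1
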